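/- Let $G$ be a compact group with a compatible bi-invariant metric $d$, let $|\cdot|$ be its Haar probability measure, let $1_\eta$ be the open ball of radius $\eta$ about the identity, and suppose that $1_\eta$ is a subgroup of $G$ for every $\eta>0$. Suppose that, for some $L\ge 1$ and $C_0\ge 1$, $G$ is $L$-locally random with coefficient $C_0$, i.e. $\|\pi(x)-\pi(y)\|_{\mathrm{op}}\le C_0(\dim\pi)^L d(x,y)$ for every irreducible unitary representation $\pi$ of $G$ and all $x,y\in G$. Suppose that, for some $C_1\ge 1$ and $d_0>0$, $C_1^{-1}\eta^{d_0}\le |1_\eta|\le C_1\eta^{d_0}$ for all $\eta\in(0,1)$. Notation. For a Borel probability measure $\nu$ on $G$ and a function $f$ on $G$, let $(\nu*f)(x)=\int f(y^{-1}x)\,d\nu(y)$; let $T_\nu f=\nu*f$ on $L^2(G)$, let $\nu^{(l)}$ be the $l$-fold convolution power of $\nu$ ($\nu^{(0)}=\delta_1$), and let $\nu_\eta=\nu*P_\eta$ with $P_\eta=\mathbf 1_{1_\eta}/|1_\eta|$. Put $H_2(\nu;\eta)=\log(1/|1_\eta|)-\log\|\nu_\eta\|_2^2$ and $h(G;\eta)=\log\mathcal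 N_\eta(G)$, where $\mathcal N_\eta(G)$ is the least number of open balls of radius $\eta$ that cover $G$. For a closed subspace $\mathcal H\subseteq L^2(G)$ let $\mathcal L(\nu;\mathcal H)=-\log\|T_\nu|_{\mathcal H}\|_{\mathrm{op}}\in(-\infty,+\infty]$. Let $L^2_0(G)=\{f\in L^2(G):\int_G f=0\}$. Let $\mu$ be a symmetric Borel probability measure on $G$ whose support generates a dense subgroup of $G$. Fix $a>1$ and $0<\eta_0<1$, and let $\eta_i=\eta_0^{a^i}$ and $\mathcal H_i=L^2(G)^{1_{\eta_i}}=\{f\in L^2(G): f(xn)=f(x)\text{ for all } n\in 1_{\eta_i}\}$. Suppose that $C_2>0$ is such that for all sufficiently large $i$ there is an integer $l_i\ge 0$ with $l_i\le C_2h(G;\eta_i)$ and $$H_2(\mu^{(l_i)};\eta_i)\ \ge\ \Bigl(1-\frac1{8Ld_0a}\Bigr)h(G;\eta_i).$$ Then: 1. there is $i_0\ge 1$ such that $\mathcal L(\mu;L^2(G)\ominus\mathcal H_{i_0})\ge \dfrac{1}{16C_2Ld_0a}$; 2. in particular there is $c>0$ such that $\operatorname{Re}\langle T_\mu f,f\rangle\le(1-c)\|f\|_2^2$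 for all $f\in L^2_0(G)$; 3. if moreover the support of $\mu$ meets every open subgroup of index $2$ in $G$ (equivalently, is not contained in the non-trivial coset of such a subgroup), then $\mathcal L(\mu;L^2_0(G))>0$. -/

import Mathlib

open MeasureTheory Filter Topology

noncomputable section

universe u

namespace LocRand

/-! ### Unitary representations, local randomness, the dimension condition -/

/-- A unitary representation of `G` on `V`: a homomorphism `G → U(V)` with jointly continuous
action map `G × V → V`. -/
structure UnitaryRep (G : Type*) [Group G] [TopologicalSpace G]
    (V : Type*) [NormedAddCommGroup V] [InnerProductSpace ℂ V] [CompleteSpace V] where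
  toHom : G →* unitary (V →L[ℂ] V)
  continuous_action : Continuous fun p : G × V => (toHom p.1 : V →L[ℂ] V) p.2

/-- Irreducibility on a finite-dimensional space (where every subspace is closed): `V ≠ 0` and
the only invariant subspaces are `0` and `V`. -/
def UnitaryRep.Irreducible {G : Type*} [Group G] [TopologicalSpace G]
    {V : Type*} [NormedAddCommGroup V] [InnerProductSpace ℂ V] [CompleteSpace V]
    (π : UnitaryRep G V) : Prop :=
  Nontrivial V ∧ ∀ W : Submodule ℂ V,
    (∀ g : G, ∀ v ∈ W, (π.toHom g : V →L[ℂ] V) v ∈ W) → W = ⊥ ∨ W = ⊤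

/-- `G` is `L`-locally random with coefficient `C₀`:
`‖π(x) - π(y)‖ ≤ C₀ (dim π)^L d(x,y)` for every irreducible unitary representation `π`.
Irreducible unitary representations of a compact group are finite-dimensional, and every one is
isomorphic to a representation on a space in the universe of `G` (inside `L²(G)`). -/
structure IsLocallyRandom (G : Type u) [Group G] [MetricSpace G] (L C₀ : ℝ) : Prop where
  one_le_L : 1 ≤ L
  one_le_C₀ : 1 ≤ C₀
  norm_sub_le : ∀ (V : Type u) [NormedAddCommGroup V] [InnerProductSpace ℂ V] [CompleteSpace V]
    [FiniteDimensional ℂ V] (π : UnitaryRep G V), π.Irreducible → ∀ x y : G,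
      ‖(π.toHom x : V →L[ℂ] V) - (π.toHom y : V →L[ℂ] V)‖
        ≤ C₀ * (Module.finrank ℂ V : ℝ) ^ L * dist x y

/-- Left and right translations are isometries. -/
def IsBiInvariantMetric (G : Type*) [Group G] [MetricSpace G] : Prop :=
  ∀ g x y : G, dist (g * x) (g * y) = dist x y ∧ dist (x * g) (y * g) = dist x y

/-- `N_η(A)`, the least number of open balls of radius `η` with centres in `A` needed to
cover `A`. -/
def coverNum {X : Type*} [MetricSpace X] (A : Set X) (η : ℝ) : ℕ :=
  sInf {n : ℕ | ∃ t : Finset X, (t : Set X) ⊆ A ∧ A ⊆ ⋃ x ∈ t, Metric.ball x η ∧ t.card = n}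

/-- The metric entropy `h(A;η) = log N_η(A)`. -/
def metricEntropy {X : Type*} [MetricSpace X] (A : Set X) (η : ℝ) : ℝ :=
  Real.log (coverNum A η)

/-! ### Haar probability measure and convolution -/

/-- The Haar probability measure of the compact group `G`. -/
def haarProb (G : Type*) [Group G] [TopologicalSpace G] [IsTopologicalGroup G] [CompactSpace G]
    [MeasurableSpace G] [BorelSpace G] : Measure G :=
  Measure.haarMeasure (⊤ : TopologicalSpace.PositiveCompacts G)

section

variable {G : Type*} [Group G] [MetricSpace G] [IsTopologicalGroup G] [CompactSpace G]
  [MeasurableSpace G] [BorelSpace G]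

instance : (haarProb G).IsHaarMeasure := by
  unfold haarProb; infer_instance

instance : IsProbabilityMeasure (haarProb G) := by
  refine ⟨?_⟩
  have := Measure.haarMeasure_self (K₀ := (⊤ : TopologicalSpace.PositiveCompacts G))
  simpa [haarProb] using this

instance : (haarProb G).IsMulRightInvariant := by
  refine ⟨fun g => ?_⟩
  have : IsProbabilityMeasure (Measure.map (fun x => x * g) (haarProb G)) :=
    Measure.isProbabilityMeasure_map (measurable_mul_const g).aemeasurable
  have h := Measure.isMulInvariant_eq_smul_of_compactSpace
    (Measure.map (fun x => x * g) (haarProb G)) (haarProb G)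
  have h1 := congrArg (fun ν : Measure G => ν Set.univ) h
  simp only [Measure.smul_apply, measure_univ] at h1
  rw [h]
  ext s _
  rw [Measure.smul_apply, ENNReal.smul_def, smul_eq_mul]
  rw [ENNReal.smul_def, smul_eq_mul, mul_one] at h1
  rw [← h1, one_mul]

variable (G) in
/-- The dimension condition `DC(C₁, d₀)`. -/
structure DimensionCondition (C₁ d₀ : ℝ) : Prop where
  one_le_C₁ : 1 ≤ C₁
  d₀_pos : 0 < d₀
  bounds : ∀ η : ℝ, 0 < η → η < 1 →
    1 / C₁ * η ^ d₀ ≤ (haarProb G).real (Metric.ball (1 : G) η) ∧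
      (haarProb G).real (Metric.ball (1 : G) η) ≤ C₁ * η ^ d₀

/-- `(μ * f)(x) = ∫ f(y⁻¹ x) dμ(y)`. -/
def convFun (μ : Measure G) (f : G → ℂ) (x : G) : ℂ := ∫ y, f (y⁻¹ * x) ∂μ

/-- `P_η`, the `L¹`-normalized indicator function of the ball `1_η`. -/
def ballDensity (η : ℝ) : G → ℂ :=
  (Metric.ball (1 : G) η).indicator
    fun _ => (((haarProb G).real (Metric.ball (1 : G) η))⁻¹ : ℝ)

/-- The Rényi entropy `H₂(μ;η) = log (1/|1_η|) - log ‖μ_η‖₂²`, where `μ_η = μ * P_η`. -/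
def renyiEntropy (μ : Measure G) (η : ℝ) : ℝ :=
  Real.log (1 / (haarProb G).real (Metric.ball (1 : G) η)) -
    Real.log ((eLpNorm (convFun μ (ballDensity η)) 2 (haarProb G)).toReal ^ 2)

/-- The convolution power `μ^{(l)}`, with `μ^{(0)}` the Dirac mass at `1`. -/
def convPow (μ : Measure G) : ℕ → Measure G
  | 0 => Measure.dirac 1
  | l + 1 => (convPow μ l).mconv μ

/-! ### The convolution operator `T_μ` on `L²(G)` -/

variable (G) in
/-- `L²(G)`, complex-valued, with respect to the Haar probability measure. -/
abbrev L2 : Type _ := Lp ℂ 2 (haarProb G)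

lemma measurePreserving_div (μ : Measure G) [IsProbabilityMeasure μ] :
    MeasurePreserving (fun p : G × G => p.2⁻¹ * p.1) ((haarProb G).prod μ) (haarProb G) := by
  have h1 : MeasurePreserving (fun p : G × G => (p.1, p.1⁻¹ * p.2))
      (μ.prod (haarProb G)) (μ.prod (haarProb G)) :=
    measurePreserving_prod_inv_mul μ (haarProb G)
  have h2 : MeasurePreserving (Prod.swap : G × G → G × G)
      ((haarProb G).prod μ) (μ.prod (haarProb G)) := Measure.measurePreserving_swap
  have h3 : MeasurePreserving (Prod.snd : G × G → G) (μ.prod (haarProb G)) (haarProb G) :=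
    measurePreserving_snd
  exact h3.comp (h1.comp h2)

lemma memLp_comp_div (μ : Measure G) [IsProbabilityMeasure μ] {f : G → ℂ}
    (hf : MemLp f 2 (haarProb G)) :
    MemLp (fun p : G × G => f (p.2⁻¹ * p.1)) 2 ((haarProb G).prod μ) :=
  hf.comp_measurePreserving (measurePreserving_div μ)

lemma ae_integrable (μ : Measure G) [IsProbabilityMeasure μ] {f : G → ℂ}
    (hf : MemLp f 2 (haarProb G)) :
    ∀ᵐ x ∂haarProb G, Integrable (fun y => f (y⁻¹ * x)) μ :=
  ((memLp_comp_div μ hf).integrable (by norm_num)).prod_right_ae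

lemma convFun_congr (μ : Measure G) [IsProbabilityMeasure μ] {f g : G → ℂ}
    (h : f =ᵐ[haarProb G] g) : convFun μ f =ᵐ[haarProb G] convFun μ g := by
  have h1 := (measurePreserving_div μ).quasiMeasurePreserving.ae_eq_comp h
  filter_upwards [Measure.ae_ae_of_ae_prod h1] with x hx
  exact integral_congr_ae hx

lemma aestronglyMeasurable_convFun (μ : Measure G) [IsProbabilityMeasure μ] {f : G → ℂ}
    (hf : MemLp f 2 (haarProb G)) : AEStronglyMeasurable (convFun μ f) (haarProb G) :=
  (memLp_comp_div μ hf).aestronglyMeasurable.integral_prod_right'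

lemma eLpNorm_convFun_le (μ : Measure G) [IsProbabilityMeasure μ] {f : G → ℂ}
    (hf : MemLp f 2 (haarProb G)) :
    eLpNorm (convFun μ f) 2 (haarProb G) ≤ eLpNorm f 2 (haarProb G) := by
  have hprod := memLp_comp_div μ hf
  rw [← eLpNorm_comp_measurePreserving hf.aestronglyMeasurable (measurePreserving_div μ)]
  rw [eLpNorm_eq_lintegral_rpow_enorm_toReal (by norm_num) (by norm_num),
    eLpNorm_eq_lintegral_rpow_enorm_toReal (by norm_num) (by norm_num)]
  refine ENNReal.rpow_le_rpow ?_ (by norm_num)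
  refine le_trans ?_ (lintegral_prod _ (hprod.aestronglyMeasurable.enorm.pow_const _)).ge
  refine lintegral_mono_ae ?_
  filter_upwards [hprod.aestronglyMeasurable.prodMk_left] with x hx
  have h1 : ‖convFun μ f x‖ₑ ≤ eLpNorm (fun y => f (y⁻¹ * x)) 2 μ := by
    refine (enorm_integral_le_lintegral_enorm _).trans ?_
    rw [← eLpNorm_one_eq_lintegral_enorm]
    exact eLpNorm_le_eLpNorm_of_exponent_le (by norm_num) hx
  refine (ENNReal.rpow_le_rpow h1 (by norm_num)).trans (le_of_eq ?_)
  rw [eLpNorm_eq_lintegral_rpow_enorm_toReal (by norm_num) (by norm_num), ← ENNReal.rpow_mul]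
  norm_num

lemma memLp_convFun (μ : Measure G) [IsProbabilityMeasure μ] {f : G → ℂ}
    (hf : MemLp f 2 (haarProb G)) : MemLp (convFun μ f) 2 (haarProb G) :=
  ⟨aestronglyMeasurable_convFun μ hf, (eLpNorm_convFun_le μ hf).trans_lt hf.2⟩

/-- The convolution operator `T_μ f = μ * f` on `L²(G)`. -/
def convOp (μ : Measure G) [IsProbabilityMeasure μ] : L2 G →L[ℂ] L2 G :=
  LinearMap.mkContinuous
    { toFun := fun f => (memLp_convFun μ (Lp.memLp f)).toLp (convFun μ f)
      map_add' := fun f g => by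
        rw [← MemLp.toLp_add]
        refine MemLp.toLp_congr _ _ ?_
        refine (convFun_congr μ (Lp.coeFn_add f g)).trans ?_
        filter_upwards [ae_integrable μ (Lp.memLp f), ae_integrable μ (Lp.memLp g)] with x hf hg
        exact integral_add hf hg
      map_smul' := fun c f => by
        rw [RingHom.id_apply, ← MemLp.toLp_const_smul]
        refine MemLp.toLp_congr _ _ ?_
        refine (convFun_congr μ (Lp.coeFn_smul c f)).trans ?_
        exact Eventually.of_forall fun x => integral_smul c _ }
    1 fun f => by
      rw [one_mul]
      change ‖(memLp_convFun μ (Lp.memLp f)).toLp (convFun μ f)‖ ≤ ‖f‖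
      rw [Lp.norm_toLp, Lp.norm_def]
      exact ENNReal.toReal_mono (Lp.eLpNorm_ne_top f) (eLpNorm_convFun_le μ (Lp.memLp f))

/-- `ℒ(μ; K) = -log ‖T_μ|_K‖_op`, with value `+∞` when `T_μ` vanishes on `K`. -/
def gap (μ : Measure G) [IsProbabilityMeasure μ] (K : Submodule ℂ (L2 G)) : EReal :=
  -ENNReal.log ‖(convOp μ).comp K.subtypeL‖ₑ

/-- `L²(G)^S`, the functions with `f(xs) = f(x)` for every `s ∈ S`. -/
def invariants (S : Set G) : Submodule ℂ (L2 G) where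
  carrier := {f | ∀ s ∈ S, (fun x => f (x * s)) =ᵐ[haarProb G] f}
  zero_mem' := fun s _ => by
    have h := Lp.coeFn_zero ℂ 2 (haarProb G)
    have h' := (measurePreserving_mul_right (haarProb G) s).quasiMeasurePreserving.ae_eq_comp h
    exact h'.trans h.symm
  add_mem' := fun {f g} hf hg s hs => by
    have h := Lp.coeFn_add f g
    have h' := (measurePreserving_mul_right (haarProb G) s).quasiMeasurePreserving.ae_eq_comp h
    exact h'.trans (((hf s hs).add (hg s hs)).trans h.symm)
  smul_mem' := fun c f hf s hs => by
    have h := Lp.coeFn_smul c f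
    have h' := (measurePreserving_mul_right (haarProb G) s).quasiMeasurePreserving.ae_eq_comp h
    exact h'.trans (((hf s hs).const_smul c).trans h.symm)

variable (G) in
/-- `L²₀(G)`, the functions in `L²(G)` with integral zero. -/
def L2Zero : Submodule ℂ (L2 G) where
  carrier := {f | ∫ x, f x ∂haarProb G = 0}
  zero_mem' := by
    change ∫ x, (0 : L2 G) x ∂haarProb G = 0
    rw [integral_congr_ae (Lp.coeFn_zero ℂ 2 (haarProb G))]
    simp
  add_mem' := fun {f g} hf hg => by
    change ∫ x, (f + g : L2 G) x ∂haarProb G = 0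
    rw [integral_congr_ae (Lp.coeFn_add f g)]
    have := integral_add ((Lp.memLp f).integrable (by norm_num))
      ((Lp.memLp g).integrable (by norm_num))
    refine this.trans ?_
    rw [hf, hg, add_zero]
  smul_mem' := fun c f hf => by
    change ∫ x, (c • f : L2 G) x ∂haarProb G = 0
    rw [integral_congr_ae (Lp.coeFn_smul c f)]
    refine (integral_smul c _).trans ?_
    rw [hf, smul_zero]

end

end LocRand

end

set_option linter.unusedSectionVars false

noncomputable section

namespace LocRand

/-! ### Spectral bounds on finite-dimensional invariant subspaces -/

/-! Write `η_i = η₀ ^ (a ^ i)` and `H_i = L²(G)^{1_{η_i}}`. By bi-invariance the balls `1_{η_i}` are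
open normal subgroups, so the `H_i` are finite-dimensional, increasing, with dense union, and stable
under right translations and under `T_μ`, which is self-adjoint. Bounding `T_μ` on `H_{i₀}ᗮ` thus
reduces to bounding eigenvalues `c` on `H_{i+1} ⊖ H_i` for `i ≥ i₀` (`norm_map_le_of_chain`). The
bound compares two estimates of a multiplicity `m`.

Lower estimate (`exists_orthonormal_eigenvectors`): `T_μ` commutes with right translations, so the
eigenspace contains an irreducible representation, of dimension `m` say. If `C₀ m^L η_i < 1`, local
randomness places the whole group `1_{η_i}` at distance less than one from the identity, hence it
acts trivially and the representation lies in `H_i`, which is absurd. So `1 ≤ C₀ m^L η_i`.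

Upper estimate (`card_mul_pow_le`): on `H_{i+1}` the operator of `ν = μ^{(l)}` has kernel `ν_η(x
z⁻¹)`, `η = η_{i+1}`, with Hilbert–Schmidt norm `‖ν_η‖₂`, whence `m |c|^{2l} ≤ ‖ν_η‖₂²`. High
entropy at a time `l ≤ C₂ h` makes this incompatible with the lower estimate at small scales, unless
`|c| ≤ exp(-1/(16 C₂ L d₀ a))` (`abs_le_exp_neg_of_multiplicity`).

What remains is the finite-dimensional space `H_{i₀} ∩ L²₀(G)`, where it suffices to exclude the
eigenvalue `1`, and `-1` for the last claim. Equality in Cauchy–Schwarz forces `F(y⁻¹x) = ±F(x)` for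
`y` in the support; density of the generated group then makes `F` constant, or produces an open
subgroup of index two that misses the support. -/

section Spectral

variable {E : Type*} [NormedAddCommGroup E] [InnerProductSpace ℂ E]

/-- An eigenbasis of a finite-dimensional subspace invariant under a symmetric operator. -/
lemma exists_eigenbasis (T : E →L[ℂ] E) (hT : (T : E →ₗ[ℂ] E).IsSymmetric)
    (K : Submodule ℂ E) [FiniteDimensional ℂ K] (hK : ∀ v ∈ K, T v ∈ K) :
    ∃ (n : ℕ) (b : OrthonormalBasis (Fin n) ℂ K) (ev : Fin n → ℝ),
      ∀ i, T (b i : E) = (ev i : ℂ) • (b i : E) := by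
  have hS := hT.restrict_invariant hK
  refine ⟨_, hS.eigenvectorBasis rfl, hS.eigenvalues rfl, fun i => ?_⟩
  exact congrArg Subtype.val (hS.apply_eigenvectorBasis rfl i)

lemma map_eq_sum_eigenbasis (T : E →L[ℂ] E) {K : Submodule ℂ E} {n : ℕ}
    (b : OrthonormalBasis (Fin n) ℂ K) (ev : Fin n → ℝ)
    (hb : ∀ i, T (b i : E) = (ev i : ℂ) • (b i : E)) (v : K) :
    T (v : E) = ((∑ i, ((ev i : ℂ) * b.repr v i) • b i : K) : E) := by
  conv_lhs => rw [← b.sum_repr v]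
  simp only [Submodule.coe_sum, Submodule.coe_smul, map_sum, map_smul, hb, smul_smul, mul_comm]

lemma norm_map_sq_eq_sum (T : E →L[ℂ] E) {K : Submodule ℂ E} {n : ℕ}
    (b : OrthonormalBasis (Fin n) ℂ K) (ev : Fin n → ℝ)
    (hb : ∀ i, T (b i : E) = (ev i : ℂ) • (b i : E)) (v : K) :
    ‖T (v : E)‖ ^ 2 = ∑ i, ev i ^ 2 * ‖b.repr v i‖ ^ 2 := by
  rw [map_eq_sum_eigenbasis T b ev hb, ← Submodule.coe_norm, ← b.sum_sq_norm_inner_right]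
  refine Finset.sum_congr rfl fun i _ => ?_
  rw [b.orthonormal.inner_right_fintype, norm_mul, mul_pow, Complex.norm_real, Real.norm_eq_abs,
    sq_abs]

lemma re_inner_map_eq_sum (T : E →L[ℂ] E) {K : Submodule ℂ E} {n : ℕ}
    (b : OrthonormalBasis (Fin n) ℂ K) (ev : Fin n → ℝ)
    (hb : ∀ i, T (b i : E) = (ev i : ℂ) • (b i : E)) (v : K) :
    (inner ℂ (T (v : E)) (v : E)).re = ∑ i, ev i * ‖b.repr v i‖ ^ 2 := by
  rw [map_eq_sum_eigenbasis T b ev hb]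
  change (inner ℂ (∑ i, ((ev i : ℂ) * b.repr v i) • b i : K) v).re = _
  rw [sum_inner, Complex.re_sum]
  refine Finset.sum_congr rfl fun i _ => ?_
  rw [inner_smul_left, ← b.repr_apply_apply, map_mul, Complex.conj_ofReal, mul_assoc,
    mul_comm (starRingEnd ℂ _), Complex.mul_conj, Complex.normSq_eq_norm_sq,
    ← Complex.ofReal_mul, Complex.ofReal_re]

lemma norm_sq_eq_sum_repr {K : Submodule ℂ E} {n : ℕ}
    (b : OrthonormalBasis (Fin n) ℂ K) (v : K) : ‖(v : E)‖ ^ 2 = ∑ i, ‖b.repr v i‖ ^ 2 := by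
  rw [← Submodule.coe_norm, ← b.sum_sq_norm_inner_right]
  simp [b.repr_apply_apply]

lemma norm_map_le_of_abs_eigenvalue_le (T : E →L[ℂ] E) (hT : (T : E →ₗ[ℂ] E).IsSymmetric)
    (K : Submodule ℂ E) [FiniteDimensional ℂ K] (hK : ∀ v ∈ K, T v ∈ K) {r : ℝ} (hr : 0 ≤ r)
    (h : ∀ (l : ℝ), ∀ v ∈ K, v ≠ 0 → T v = (l : ℂ) • v → |l| ≤ r) :
    ∀ v ∈ K, ‖T v‖ ≤ r * ‖v‖ := by
  obtain ⟨n, b, ev, hb⟩ := exists_eigenbasis T hT K hK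
  have hev : ∀ i, |ev i| ≤ r := fun i =>
    h (ev i) (b i) (b i).2 (by simpa using b.toBasis.ne_zero i) (hb i)
  intro v hv
  refine le_of_sq_le_sq ?_ (by positivity)
  rw [mul_pow, norm_map_sq_eq_sum T b ev hb ⟨v, hv⟩, norm_sq_eq_sum_repr b ⟨v, hv⟩,
    Finset.mul_sum]
  exact Finset.sum_le_sum fun i _ => mul_le_mul_of_nonneg_right
    (sq_le_sq' (by linarith [neg_abs_le (ev i), hev i]) (le_of_abs_le (hev i))) (by positivity)

/-- There are finitely many eigenvalues, so the strict bound survives passing to the maximum; when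
`K = 0` there is none and `r = 0` serves. -/
lemma exists_norm_map_le_of_abs_eigenvalue_lt (T : E →L[ℂ] E)
    (hT : (T : E →ₗ[ℂ] E).IsSymmetric)
    (K : Submodule ℂ E) [FiniteDimensional ℂ K] (hK : ∀ v ∈ K, T v ∈ K)
    (h : ∀ (l : ℝ), ∀ v ∈ K, v ≠ 0 → T v = (l : ℂ) • v → |l| < 1) :
    ∃ r : ℝ, 0 ≤ r ∧ r < 1 ∧ ∀ v ∈ K, ‖T v‖ ≤ r * ‖v‖ := by
  obtain ⟨n, b, ev, hb⟩ := exists_eigenbasis T hT K hK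
  have hev : ∀ i, |ev i| < 1 := fun i =>
    h (ev i) (b i) (b i).2 (by simpa using b.toBasis.ne_zero i) (hb i)
  obtain ⟨r, hr, hr1⟩ : ∃ r : ℝ, (0 ≤ r ∧ ∀ i, |ev i| ≤ r) ∧ r < 1 := by
    rcases isEmpty_or_nonempty (Fin n) with hn | hn
    · exact ⟨0, ⟨le_rfl, fun i => hn.elim i⟩, one_pos⟩
    · obtain ⟨i, hi⟩ := Finite.exists_max fun i => |ev i|
      exact ⟨|ev i|, ⟨abs_nonneg _, hi⟩, hev i⟩
  refine ⟨r, hr.1, hr1, fun v hv => ?_⟩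
  have hr0 := hr.1
  refine le_of_sq_le_sq ?_ (by positivity)
  rw [mul_pow, norm_map_sq_eq_sum T b ev hb ⟨v, hv⟩, norm_sq_eq_sum_repr b ⟨v, hv⟩,
    Finset.mul_sum]
  exact Finset.sum_le_sum fun i _ => mul_le_mul_of_nonneg_right
    (sq_le_sq' (by linarith [neg_abs_le (ev i), hr.2 i]) (le_of_abs_le (hr.2 i))) (by positivity)

lemma exists_re_inner_map_le_of_eigenvalue_lt (T : E →L[ℂ] E)
    (hT : (T : E →ₗ[ℂ] E).IsSymmetric)
    (K : Submodule ℂ E) [FiniteDimensional ℂ K] (hK : ∀ v ∈ K, T v ∈ K)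
    (h : ∀ (l : ℝ), ∀ v ∈ K, v ≠ 0 → T v = (l : ℂ) • v → l < 1) :
    ∃ r : ℝ, r < 1 ∧ ∀ v ∈ K, (inner ℂ (T v) v).re ≤ r * ‖v‖ ^ 2 := by
  obtain ⟨n, b, ev, hb⟩ := exists_eigenbasis T hT K hK
  have hev : ∀ i, ev i < 1 := fun i =>
    h (ev i) (b i) (b i).2 (by simpa using b.toBasis.ne_zero i) (hb i)
  obtain ⟨r, hr, hr1⟩ : ∃ r : ℝ, (∀ i, ev i ≤ r) ∧ r < 1 := by
    rcases isEmpty_or_nonempty (Fin n) with hn | hn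
    · exact ⟨0, fun i => hn.elim i, one_pos⟩
    · obtain ⟨i, hi⟩ := Finite.exists_max ev
      exact ⟨ev i, hi, hev i⟩
  refine ⟨r, hr1, fun v hv => ?_⟩
  rw [re_inner_map_eq_sum T b ev hb ⟨v, hv⟩, norm_sq_eq_sum_repr b ⟨v, hv⟩,
    Finset.mul_sum]
  gcongr with i
  exact hr i

/-- An isometry all of whose iterates stay at distance less than one from the identity is the
identity. -/
lemma eq_of_forall_norm_iterate_sub_le (U : E →ₗᵢ[ℂ] E) (c : ℝ) (hc : c < 1) (V : Submodule ℂ E)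
    (hV : ∀ v ∈ V, U v ∈ V)
    (h : ∀ n : ℕ, ∀ v ∈ V, ‖U^[n] v - v‖ ≤ c * ‖v‖) : ∀ v ∈ V, U v = v := by
  have hadd : ∀ n (v w : E), U^[n] (v - w) = U^[n] v - U^[n] w := fun n v w => by
    induction n generalizing v w with
    | zero => rfl
    | succ n ih => simp [Function.iterate_succ, *]
  have hmem : ∀ n, ∀ v ∈ V, U^[n] v ∈ V := fun n => by
    induction n with
    | zero => exact fun v hv => hv
    | succ n ih => exact fun v hv => by rw [Function.iterate_succ]; exact ih _ (hV v hv)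
  -- Doubling: with `W = U^[2 ^ k]`, `W²v - v = 2(Wv - v) + (W - 1)(Wv - v)`, and the last term has
  -- norm at most `c‖Wv - v‖`. Each doubling therefore multiplies the displacement by at least `2 -
  -- c > 1`, which a bounded displacement cannot sustain unless it is zero.
  have hpow : ∀ k : ℕ, ∀ v ∈ V, (2 - c) ^ k * ‖U v - v‖ ≤ ‖U^[2 ^ k] v - v‖ := by
    intro k
    induction k with
    | zero => intro v _; simp
    | succ k ih =>
      intro v hv
      have e1 : U^[2 ^ (k + 1)] v - v =
          (2 : ℂ) • (U^[2 ^ k] v - v)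
            + (U^[2 ^ k] (U^[2 ^ k] v - v) - (U^[2 ^ k] v - v)) := by
        rw [hadd, ← Function.iterate_add_apply, pow_succ, mul_two, two_smul]
        abel
      have h1 := h (2 ^ k) _ (V.sub_mem (hmem (2 ^ k) v hv) hv)
      have h2 : 2 * ‖U^[2 ^ k] v - v‖ - c * ‖U^[2 ^ k] v - v‖ ≤ ‖U^[2 ^ (k + 1)] v - v‖ := by
        rw [e1]
        have h3 := norm_sub_norm_le ((2 : ℂ) • (U^[2 ^ k] v - v))
          (-(U^[2 ^ k] (U^[2 ^ k] v - v) - (U^[2 ^ k] v - v)))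
        rw [norm_neg, sub_neg_eq_add, norm_smul] at h3
        simp only [Complex.norm_ofNat] at h3
        linarith
      calc (2 - c) ^ (k + 1) * ‖U v - v‖ = (2 - c) * ((2 - c) ^ k * ‖U v - v‖) := by ring
        _ ≤ (2 - c) * ‖U^[2 ^ k] v - v‖ := by
          have := ih v hv
          gcongr
          linarith
        _ ≤ _ := by linarith
  intro v hv
  by_contra hne
  have hpos : 0 < ‖U v - v‖ := norm_pos_iff.2 (sub_ne_zero.2 hne)
  obtain ⟨k, hk⟩ := pow_unbounded_of_one_lt (‖v‖ / ‖U v - v‖) (show 1 < 2 - c by linarith)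
  rw [div_lt_iff₀ hpos] at hk
  have := hpow k v hv
  have h4 := h (2 ^ k) v hv
  nlinarith [norm_nonneg v]

end Spectral

section

variable {G : Type*} [Group G] [MetricSpace G] [IsTopologicalGroup G] [CompactSpace G]
  [MeasurableSpace G] [BorelSpace G]

/-! ### Functions invariant under right translation by an open subgroup -/

instance : (haarProb G).IsInvInvariant := by
  have : IsProbabilityMeasure (haarProb G).inv :=
    Measure.isProbabilityMeasure_map measurable_inv.aemeasurable
  have : (haarProb G).inv.IsMulLeftInvariant := inferInstance
  refine ⟨?_⟩
  have h := Measure.isMulInvariant_eq_smul_of_compactSpace (haarProb G).inv (haarProb G)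
  have h1 := congrArg (fun ν : Measure G => ν Set.univ) h
  simp only [Measure.smul_apply, measure_univ] at h1
  rw [h]
  ext s _
  rw [Measure.smul_apply, ENNReal.smul_def, smul_eq_mul]
  rw [ENNReal.smul_def, smul_eq_mul, mul_one] at h1
  rw [← h1, one_mul]

/-- Invariance of a function under right translation by `N`, at every point. -/
def RightInv (N : Subgroup G) (F : G → ℂ) : Prop := ∀ x, ∀ n ∈ N, F (x * n) = F x

lemma RightInv.left {N : Subgroup G} [hN : N.Normal] {F : G → ℂ} (hF : RightInv N F) (x n : G)
    (hn : n ∈ N) : F (n * x) = F x := by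
  have := hF x (x⁻¹ * n * x) (by simpa using hN.conj_mem n hn x⁻¹)
  rwa [← mul_assoc, ← mul_assoc, mul_inv_cancel, one_mul] at this

/-- `F` is constant on open cosets. Continuity is what later upgrades almost-everywhere identities
to identities at every point. -/
lemma RightInv.continuous {N : Subgroup G} (hN : IsOpen (N : Set G)) {F : G → ℂ}
    (hF : RightInv N F) : Continuous F := by
  refine IsLocallyConstant.continuous ((IsLocallyConstant.iff_exists_open F).2 fun x =>
    ⟨(fun y => x⁻¹ * y) ⁻¹' N, hN.preimage (continuous_const_mul _), by simp, fun y hy => ?_⟩)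
  have := hF x (x⁻¹ * y) hy
  rwa [mul_inv_cancel_left] at this

lemma _root_.Continuous.memLp_haarProb {F : G → ℂ} (hF : Continuous F) :
    MemLp F 2 (haarProb G) := by
  obtain ⟨C, hC⟩ := (isCompact_range hF).isBounded.exists_norm_le
  exact MemLp.of_bound hF.aestronglyMeasurable C
    (Eventually.of_forall fun x => hC _ (Set.mem_range_self x))

lemma _root_.Continuous.integrable_of_compactSpace {X E : Type*} [TopologicalSpace X]
    [CompactSpace X] [MeasurableSpace X] [OpensMeasurableSpace X] [NormedAddCommGroup E]
    [SecondCountableTopology E] {F : X → E} (hF : Continuous F) (ν : Measure X)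
    [IsFiniteMeasure ν] : Integrable F ν :=
  hF.integrable_of_hasCompactSupport (HasCompactSupport.of_compactSpace F)

lemma RightInv.toLp_mem_invariants {N : Subgroup G} {F : G → ℂ}
    (hF : RightInv N F) (hc : MemLp F 2 (haarProb G)) : hc.toLp F ∈ invariants (N : Set G) := by
  intro s hs
  have h := hc.coeFn_toLp
  have h' := (measurePreserving_mul_right (haarProb G) s).quasiMeasurePreserving.ae_eq_comp h
  refine h'.trans (EventuallyEq.trans ?_ h.symm)
  exact Eventually.of_forall fun x => hF x s hs

lemma haarProb_real_pos {N : Subgroup G} (hN : IsOpen (N : Set G)) :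
    0 < (haarProb G).real (N : Set G) :=
  ENNReal.toReal_pos (hN.measure_pos _ ⟨1, N.one_mem⟩).ne' (measure_ne_top _ _)

/-- A vector of `L²(G)^N` is represented by a function invariant under `N` at every point. -/
lemma exists_rightInv_ae_eq {N : Subgroup G} (hN : IsOpen (N : Set G)) {f : L2 G}
    (hf : f ∈ invariants (N : Set G)) :
    ∃ F : G → ℂ, RightInv N F ∧ f =ᵐ[haarProb G] F := by
  set c := (haarProb G).real (N : Set G)
  have hc : c ≠ 0 := (haarProb_real_pos hN).ne'
  -- The average of `f` over the coset `xN`: it depends on `x` only through that coset, so its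
  -- invariance is exact.
  refine ⟨fun x => (c : ℂ)⁻¹ * ∫ z, (N : Set G).indicator (fun _ => f z) (x⁻¹ * z) ∂haarProb G,
    fun x n hn => ?_, ?_⟩
  · refine congrArg _ (integral_congr_ae (Eventually.of_forall fun z => ?_))
    dsimp only
    by_cases h : x⁻¹ * z ∈ N
    · rw [Set.indicator_of_mem h, Set.indicator_of_mem]
      simpa [mul_assoc] using N.mul_mem (N.inv_mem hn) h
    · rw [Set.indicator_of_notMem h, Set.indicator_of_notMem]
      intro h'
      refine h ?_
      have := N.mul_mem hn h'
      simpa [mul_assoc] using this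
  -- The exceptional null set of `x` depends on `n`; Fubini exchanges the quantifiers, so that for
  -- almost every `x` the average is over values equal to `f x`.
  · have hm : MeasurableSet {p : G × G | p.1 ∈ N → f (p.2 * p.1) = f p.2} := by
      have hfm : Measurable f := (Lp.stronglyMeasurable f).measurable
      have h1 : MeasurableSet {p : G × G | p.1 ∈ N} := hN.measurableSet.preimage measurable_fst
      have h2 : MeasurableSet {p : G × G | f (p.2 * p.1) = f p.2} :=
        measurableSet_eq_fun (hfm.comp (measurable_snd.mul measurable_fst))
          (hfm.comp measurable_snd)
      exact h1.imp h2
    have h1 : ∀ᵐ n ∂haarProb G, ∀ᵐ x ∂haarProb G, n ∈ N → f (x * n) = f x :=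
      Eventually.of_forall fun n => by
        by_cases hn : n ∈ N
        · filter_upwards [hf n hn] with x hx _ using hx
        · exact Eventually.of_forall fun x hx => (hn hx).elim
    have h2 := (Measure.ae_ae_comm hm).1 h1
    filter_upwards [h2] with x hx
    have h3 : ∫ z, (N : Set G).indicator (fun _ => f z) (x⁻¹ * z) ∂haarProb G
        = ∫ n, (N : Set G).indicator (fun _ => f x) n ∂haarProb G := by
      rw [← integral_mul_left_eq_self _ x]
      refine integral_congr_ae ?_
      filter_upwards [hx] with n hn
      rw [inv_mul_cancel_left]
      by_cases h : n ∈ (N : Set G)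
      · rw [Set.indicator_of_mem h, Set.indicator_of_mem h, hn h]
      · rw [Set.indicator_of_notMem h, Set.indicator_of_notMem h]
    rw [h3, integral_indicator_const _ hN.measurableSet, Complex.real_smul,
      inv_mul_cancel_left₀ (Complex.ofReal_ne_zero.2 hc)]

/-- An open subgroup of a compact group has finite index, and invariant vectors come from functions
on `G ⧸ N`. -/
lemma finiteDimensional_invariants {N : Subgroup G} (hN : IsOpen (N : Set G)) :
    FiniteDimensional ℂ (invariants (N : Set G)) := by
  have : Finite (G ⧸ N) := N.quotient_finite_of_isOpen hN
  have hinv : ∀ g : G ⧸ N → ℂ, RightInv N fun x => g (QuotientGroup.mk x) := fun g x n hn => by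
    simp only [QuotientGroup.mk_mul_of_mem x hn]
  have hmem := fun g => ((hinv g).continuous hN).memLp_haarProb
  let Φ : (G ⧸ N → ℂ) →ₗ[ℂ] L2 G :=
    { toFun := fun g => (hmem g).toLp _
      map_add' := fun g h => (hmem g).toLp_add (hmem h)
      map_smul' := fun c g => (hmem g).toLp_const_smul c }
  have hle : invariants (N : Set G) ≤ LinearMap.range Φ := by
    intro f hf
    obtain ⟨F, hF, hfF⟩ := exists_rightInv_ae_eq hN hf
    refine ⟨Quotient.lift F fun x y hxy => ?_, ?_⟩
    · have := hF x (x⁻¹ * y) (QuotientGroup.leftRel_apply.1 hxy)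
      rw [mul_inv_cancel_left] at this
      exact this.symm
    · refine Lp.ext ?_
      exact (hmem (Quotient.lift F _)).coeFn_toLp.trans hfF.symm
  exact Submodule.finiteDimensional_of_le hle

/-! ### Density of the invariant vectors -/

/-- Sample `F` at one representative of each coset: a coset of `1_η` is a ball of radius `η` about
any of its points, so uniform continuity controls the error. -/
lemma exists_rightInv_norm_sub_le {F : G → ℂ} (hF : Continuous F) {ε : ℝ} (hε : 0 < ε) :
    ∃ δ > 0, ∀ η ≤ δ, ∀ N : Subgroup G, (N : Set G) = Metric.ball 1 η →
      IsBiInvariantMetric G →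
      ∃ F' : G → ℂ, RightInv N F' ∧ ∀ x, ‖F' x - F x‖ ≤ ε := by
  obtain ⟨δ, hδ, h⟩ := Metric.uniformContinuous_iff.1
    (CompactSpace.uniformContinuous_of_continuous hF) ε hε
  refine ⟨δ, hδ, fun η hη N hN hbi =>
    ⟨fun x => F (QuotientGroup.mk (s := N) x).out, fun x n hn => ?_, fun x => ?_⟩⟩
  · simp only [QuotientGroup.mk_mul_of_mem x hn]
  · rw [← dist_eq_norm]
    refine (h ?_).le
    obtain ⟨n, hn⟩ := QuotientGroup.mk_out_eq_mul N x
    rw [hn]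
    have h1 : (n : G) ∈ Metric.ball (1 : G) η := hN ▸ n.2
    have h2 := (hbi x n 1).1
    rw [mul_one] at h2
    rw [h2]
    exact (Metric.mem_ball.1 h1).trans_le hη

lemma invariants_anti {S S' : Set G} (h : S ⊆ S') : invariants S' ≤ invariants S :=
  fun _ hf s hs => hf s (h hs)

lemma top_le_topologicalClosure_iSup_invariants (hbi : IsBiInvariantMetric G)
    (hball : ∀ η : ℝ, 0 < η → ∃ N : Subgroup G, (N : Set G) = Metric.ball (1 : G) η)
    {η : ℕ → ℝ} (hη : ∀ i, 0 < η i) (hlim : Tendsto η atTop (𝓝 0)) :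
    ⊤ ≤ (⨆ i, invariants (Metric.ball (1 : G) (η i))).topologicalClosure := by
  intro f _
  change f ∈ closure _
  rw [Metric.mem_closure_iff]
  intro ε hε
  obtain ⟨F, hF⟩ := Metric.denseRange_iff.1
    (ContinuousMap.toLp_denseRange ℂ (haarProb G) ℂ (by norm_num : (2 : ENNReal) ≠ ⊤)) f (ε / 2)
    (by positivity)
  obtain ⟨δ, hδ, h⟩ := exists_rightInv_norm_sub_le F.continuous (show 0 < ε / 4 by positivity)
  obtain ⟨i, hi⟩ := (hlim.eventually_lt_const hδ).exists
  obtain ⟨N, hN⟩ := hball (η i) (hη i)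
  obtain ⟨F', hF', hFF'⟩ := h (η i) hi.le N hN hbi
  have hopen : IsOpen (N : Set G) := hN ▸ Metric.isOpen_ball
  have hm := (hF'.continuous hopen).memLp_haarProb
  refine ⟨hm.toLp F', Submodule.mem_iSup_of_mem i ?_, ?_⟩
  · rw [← hN]
    exact hF'.toLp_mem_invariants hm
  · suffices h' : dist (ContinuousMap.toLp 2 (haarProb G) ℂ F) (hm.toLp F') ≤ ε / 2 by
      linarith [dist_triangle f (ContinuousMap.toLp 2 (haarProb G) ℂ F) (hm.toLp F')]
    rw [dist_comm, dist_eq_norm]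
    refine (Lp.norm_le_of_ae_bound (C := ε / 4) (by positivity) ?_).trans ?_
    · filter_upwards [Lp.coeFn_sub (hm.toLp F') (ContinuousMap.toLp 2 (haarProb G) ℂ F),
        hm.coeFn_toLp, ContinuousMap.coeFn_toLp (p := 2) (haarProb G) (𝕜 := ℂ) F] with x h1 h2 h3
      rw [h1, Pi.sub_apply, h2, h3]
      exact hFF' x
    · simp only [measureUnivNNReal, measure_univ, ENNReal.toNNReal_one]
      simp
      linarith

/-! ### Right translations -/

/-- The right translation `(R_g f)(x) = f(xg)` on `L²(G)`. -/
def rightTrans (g : G) : L2 G →ₗᵢ[ℂ] L2 G :=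
  Lp.compMeasurePreservingₗᵢ ℂ (fun x => x * g) (measurePreserving_mul_right (haarProb G) g)

lemma coeFn_rightTrans (g : G) (f : L2 G) : rightTrans g f =ᵐ[haarProb G] fun x => f (x * g) :=
  Lp.coeFn_compMeasurePreserving f (measurePreserving_mul_right (haarProb G) g)

lemma ae_comp_mul_right {p : G → Prop} (h : ∀ᵐ x ∂haarProb G, p x) (g : G) :
    ∀ᵐ x ∂haarProb G, p (x * g) :=
  (measurePreserving_mul_right (haarProb G) g).quasiMeasurePreserving.ae h

lemma mem_invariants_iff {S : Set G} {f : L2 G} :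
    f ∈ invariants S ↔ ∀ s ∈ S, rightTrans s f = f :=
  forall₂_congr fun s _ => ⟨fun h => Lp.ext ((coeFn_rightTrans s f).trans h),
    fun h => (coeFn_rightTrans s f).symm.trans (by rw [h])⟩

lemma rightTrans_mul (g h : G) (f : L2 G) :
    rightTrans (g * h) f = rightTrans g (rightTrans h f) := by
  refine Lp.ext ?_
  filter_upwards [coeFn_rightTrans (g * h) f, coeFn_rightTrans g (rightTrans h f),
    ae_comp_mul_right (coeFn_rightTrans h f) g] with x h1 h2 h3
  rw [h1, h2, h3, mul_assoc]

lemma rightTrans_one (f : L2 G) : rightTrans 1 f = f := by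
  refine Lp.ext ?_
  filter_upwards [coeFn_rightTrans 1 f] with x h1
  rw [h1, mul_one]

lemma rightTrans_pow (g : G) (n : ℕ) (f : L2 G) :
    rightTrans (g ^ n) f = (rightTrans g)^[n] f := by
  induction n generalizing f with
  | zero => rw [pow_zero, rightTrans_one]; rfl
  | succ n ih => rw [pow_succ, rightTrans_mul, ih, Function.iterate_succ_apply]

lemma inner_rightTrans_left (g : G) (f h : L2 G) :
    inner ℂ (rightTrans g f) h = inner ℂ f (rightTrans g⁻¹ h) := by
  rw [← (rightTrans g).inner_map_map f, ← rightTrans_mul, mul_inv_cancel, rightTrans_one]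

lemma rightTrans_mem_invariants {N : Subgroup G} [hN : N.Normal] {f : L2 G}
    (hf : f ∈ invariants (N : Set G)) (g : G) : rightTrans g f ∈ invariants (N : Set G) := by
  rw [mem_invariants_iff] at hf ⊢
  intro s hs
  have h := hf (g⁻¹ * s * g) (by simpa using hN.conj_mem s hs g⁻¹)
  calc rightTrans s (rightTrans g f) = rightTrans (g * (g⁻¹ * s * g)) f := by
        rw [← rightTrans_mul]; group
    _ = rightTrans g f := by rw [rightTrans_mul, h]

lemma rightTrans_mem_invariants_orthogonal {N : Subgroup G} [N.Normal] {f : L2 G}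
    (hf : f ∈ (invariants (N : Set G))ᗮ) (g : G) :
    rightTrans g f ∈ (invariants (N : Set G))ᗮ := by
  rw [Submodule.mem_orthogonal'] at hf ⊢
  intro u hu
  rw [inner_rightTrans_left]
  exact hf _ (rightTrans_mem_invariants hu _)

/-! ### The convolution operator -/

lemma coeFn_convOp (μ : Measure G) [IsProbabilityMeasure μ] (f : L2 G) :
    convOp μ f =ᵐ[haarProb G] convFun μ f :=
  (memLp_convFun μ (Lp.memLp f)).coeFn_toLp

lemma coeFn_convOp_of_ae_eq (μ : Measure G) [IsProbabilityMeasure μ] {f : L2 G} {F : G → ℂ}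
    (h : f =ᵐ[haarProb G] F) : convOp μ f =ᵐ[haarProb G] convFun μ F :=
  (coeFn_convOp μ f).trans (convFun_congr μ h)

lemma norm_convOp_le (μ : Measure G) [IsProbabilityMeasure μ] (f : L2 G) :
    ‖convOp μ f‖ ≤ ‖f‖ := by
  rw [convOp]
  refine (ContinuousLinearMap.le_of_opNorm_le _ (LinearMap.mkContinuous_norm_le _ zero_le_one _)
    f).trans (one_mul _).le

/-- Convolution acts on the argument from the left and translation from the right. This is what
makes eigenspaces of `T_μ` representations of `G`. -/
lemma convOp_rightTrans (μ : Measure G) [IsProbabilityMeasure μ] (g : G) (f : L2 G) :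
    convOp μ (rightTrans g f) = rightTrans g (convOp μ f) := by
  refine Lp.ext ?_
  filter_upwards [coeFn_convOp_of_ae_eq μ (coeFn_rightTrans g f),
    coeFn_rightTrans g (convOp μ f), ae_comp_mul_right (coeFn_convOp μ f) g] with x h1 h2 h3
  rw [h1, h2, h3]
  simp only [convFun, mul_assoc]

lemma convOp_mem_invariants (μ : Measure G) [IsProbabilityMeasure μ] {S : Set G} {f : L2 G}
    (hf : f ∈ invariants S) : convOp μ f ∈ invariants S := by
  rw [mem_invariants_iff] at hf ⊢
  intro s hs
  rw [← convOp_rightTrans, hf s hs]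

/-- The map is an involution exchanging `x` with `y⁻¹x`; as a change of variables it swaps the two
functions in the double integral for `⟨g, T_μ f⟩`, which yields self-adjointness. -/
lemma measurePreserving_div_inv (μ : Measure G) [IsProbabilityMeasure μ]
    (hsymm : μ.map (fun x => x⁻¹) = μ) :
    MeasurePreserving (fun p : G × G => (p.2⁻¹ * p.1, p.2⁻¹))
      ((haarProb G).prod μ) ((haarProb G).prod μ) := by
  have h1 : MeasurePreserving (fun p : G × G => (p.1, p.1⁻¹ * p.2))
      (μ.prod (haarProb G)) (μ.prod (haarProb G)) :=
    measurePreserving_prod_inv_mul μ (haarProb G)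
  have h2 : MeasurePreserving (fun x : G => x⁻¹) μ μ := ⟨measurable_inv, hsymm⟩
  have h3 := (h2.prod (MeasurePreserving.id (haarProb G)))
  exact (Measure.measurePreserving_swap.comp (h3.comp h1)).comp
    (Measure.measurePreserving_swap (μ := haarProb G) (ν := μ))

lemma integral_inner_convFun (μ : Measure G) [IsProbabilityMeasure μ] {f g : G → ℂ}
    (hf : MemLp f 2 (haarProb G)) (hg : MemLp g 2 (haarProb G)) :
    ∫ x, inner ℂ (g x) (convFun μ f x) ∂haarProb G =
      ∫ p : G × G, inner ℂ (g p.1) (f (p.2⁻¹ * p.1)) ∂((haarProb G).prod μ) := by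
  have hint : Integrable (fun p : G × G => inner ℂ (g p.1) (f (p.2⁻¹ * p.1)))
      ((haarProb G).prod μ) := by
    have h1 : MemLp (fun p : G × G => g p.1) 2 ((haarProb G).prod μ) :=
      hg.comp_measurePreserving measurePreserving_fst
    simpa [RCLike.inner_apply] using! (memLp_comp_div μ hf).integrable_mul h1.star
  rw [integral_prod _ hint]
  refine integral_congr_ae ?_
  filter_upwards [ae_integrable μ hf] with x hx
  exact (integral_inner hx (g x)).symm

lemma isSymmetric_convOp (μ : Measure G) [IsProbabilityMeasure μ]
    (hsymm : μ.map (fun x => x⁻¹) = μ) : (convOp μ : L2 G →ₗ[ℂ] L2 G).IsSymmetric := by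
  have key : ∀ f g : L2 G, inner ℂ g (convOp μ f) =
      ∫ p : G × G, inner ℂ (g p.1) (f (p.2⁻¹ * p.1)) ∂((haarProb G).prod μ) := fun f g => by
    rw [L2.inner_def, ← integral_inner_convFun μ (Lp.memLp f) (Lp.memLp g)]
    refine integral_congr_ae ?_
    filter_upwards [coeFn_convOp μ f] with x hx
    rw [hx]
  intro f g
  change inner ℂ (convOp μ f) g = inner ℂ f (convOp μ g)
  rw [← inner_conj_symm, key, key, ← integral_conj]
  have hmeas : AEStronglyMeasurable (fun p : G × G => inner ℂ (f p.1) (g (p.2⁻¹ * p.1)))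
      ((haarProb G).prod μ) :=
    ((Lp.memLp f).comp_measurePreserving measurePreserving_fst).aestronglyMeasurable.inner
      (memLp_comp_div μ (Lp.memLp g)).aestronglyMeasurable
  have h := measurePreserving_div_inv μ hsymm
  conv_rhs => rw [← h.map_eq]
  rw [integral_map h.measurable.aemeasurable (by rwa [h.map_eq])]
  refine integral_congr_ae (Eventually.of_forall fun p => ?_)
  simp only [inner_conj_symm, inv_inv, mul_inv_cancel_left]

/-! ### Multiplicity bound for eigenvalues -/

lemma RightInv.convFun {N : Subgroup G} {F : G → ℂ} (hF : RightInv N F) (ν : Measure G) :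
    RightInv N (convFun ν F) := fun x n hn => by
  simp only [LocRand.convFun, ← mul_assoc]
  simp only [hF _ n hn]

lemma rightInv_ballDensity {N : Subgroup G} {η : ℝ} (hN : (N : Set G) = Metric.ball 1 η) :
    RightInv N (ballDensity η) := fun x n hn => by
  unfold ballDensity
  rw [← hN]
  by_cases h : x ∈ N
  · rw [Set.indicator_of_mem h, Set.indicator_of_mem (N.mul_mem h hn)]
  · rw [Set.indicator_of_notMem h, Set.indicator_of_notMem]
    exact fun h' => h ((N.mul_mem_cancel_right hn).1 h')

lemma integral_ballDensity {η : ℝ} (hη : 0 < η) :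
    ∫ z, ballDensity η z ∂haarProb G = 1 := by
  have h : (haarProb G).real (Metric.ball (1 : G) η) ≠ 0 :=
    (ENNReal.toReal_pos (Metric.measure_ball_pos _ _ hη).ne' (measure_ne_top _ _)).ne'
  unfold ballDensity
  rw [integral_indicator_const _ Metric.isOpen_ball.measurableSet, Complex.real_smul,
    ← Complex.ofReal_mul, mul_inv_cancel₀ h, Complex.ofReal_one]

/-- On functions invariant under the ball `1_η`, convolution by `ν` is an integral operator with
kernel `ν_η(x z⁻¹)`. -/
lemma integral_mul_convFun_ballDensity {N : Subgroup G} [hNn : N.Normal] {η : ℝ} (hη : 0 < η)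
    (hN : (N : Set G) = Metric.ball 1 η) (ν : Measure G) [IsProbabilityMeasure ν] {F : G → ℂ}
    (hF : RightInv N F) (x : G) :
    ∫ z, F z * convFun ν (ballDensity η) (x * z⁻¹) ∂haarProb G = convFun ν F x := by
  have hopen : IsOpen (N : Set G) := hN ▸ Metric.isOpen_ball
  have hP : Continuous (ballDensity η : G → ℂ) := (rightInv_ballDensity hN).continuous hopen
  have hFc := hF.continuous hopen
  simp only [convFun, ← integral_const_mul]
  rw [integral_integral_swap]
  · refine integral_congr_ae (Eventually.of_forall fun y => ?_)
    -- Where the density is non-zero, `y⁻¹xz⁻¹ ∈ N`, and left invariance of `F` (from normality of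
    -- `N`) replaces `F z` by `F (y⁻¹x)`.
    have h1 : ∀ z, F z * ballDensity η (y⁻¹ * (x * z⁻¹))
        = F (y⁻¹ * x) * ballDensity η (y⁻¹ * x * z⁻¹) := fun z => by
      rw [← mul_assoc y⁻¹]
      by_cases h : y⁻¹ * x * z⁻¹ ∈ (N : Set G)
      · have h2 := hF.left z _ h
        rw [inv_mul_cancel_right] at h2
        rw [h2]
      · unfold ballDensity
        rw [← hN, Set.indicator_of_notMem h, mul_zero, mul_zero]
    simp only [h1]
    rw [integral_const_mul, integral_inv_eq_self (fun z => ballDensity η (y⁻¹ * x * z)),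
      integral_mul_left_eq_self (ballDensity η), integral_ballDensity hη, mul_one]
  · refine Continuous.integrable_of_compactSpace ?_ _
    unfold Function.uncurry
    fun_prop

/-- Bessel's inequality for the kernel `z ↦ conj ν_η(x z⁻¹)`: its inner products with the `f i` have
the moduli of the values `(ν * F i)(x)`, and its norm is `‖ν_η‖₂` by invariance of Haar measure
under `z ↦ x z⁻¹`. -/
lemma sum_norm_sq_convFun_le {N : Subgroup G} [N.Normal] {η : ℝ} (hη : 0 < η)
    (hN : (N : Set G) = Metric.ball 1 η) (ν : Measure G) [IsProbabilityMeasure ν]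
    {ι : Type*} [Fintype ι] {f : ι → L2 G} (hf : Orthonormal ℂ f) {F : ι → G → ℂ}
    (hF : ∀ i, RightInv N (F i)) (hfF : ∀ i, f i =ᵐ[haarProb G] F i) (x : G) :
    ∑ i, ‖convFun ν (F i) x‖ ^ 2
      ≤ (eLpNorm (convFun ν (ballDensity η)) 2 (haarProb G)).toReal ^ 2 := by
  have hopen : IsOpen (N : Set G) := hN ▸ Metric.isOpen_ball
  have hρ : Continuous (convFun ν (ballDensity η) : G → ℂ) :=
    ((rightInv_ballDensity hN).convFun ν).continuous hopen
  set ρ : G → ℂ := convFun ν (ballDensity η) with hρdef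
  have hk : MemLp (fun z => star (ρ (x * z⁻¹))) 2 (haarProb G) :=
    Continuous.memLp_haarProb (by fun_prop)
  have hnorm : ‖hk.toLp _‖ = (eLpNorm ρ 2 (haarProb G)).toReal := by
    rw [Lp.norm_toLp]
    congr 1
    have hmp : MeasurePreserving (fun z : G => x * z⁻¹) (haarProb G) (haarProb G) :=
      (measurePreserving_mul_left (haarProb G) x).comp (Measure.measurePreserving_inv (haarProb G))
    rw [← eLpNorm_comp_measurePreserving hρ.aestronglyMeasurable hmp]
    exact eLpNorm_congr_norm_ae (Eventually.of_forall fun z => norm_star _)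
  have hinner : ∀ i, ‖inner ℂ (f i) (hk.toLp _)‖ = ‖convFun ν (F i) x‖ := fun i => by
    rw [norm_inner_symm, L2.inner_def, ← integral_mul_convFun_ballDensity hη hN ν (hF i) x]
    congr 1
    refine integral_congr_ae ?_
    filter_upwards [hk.coeFn_toLp, hfF i] with z h1 h2
    rw [h1, h2, RCLike.inner_apply, Complex.star_def, Complex.conj_conj]
  have := hf.sum_inner_products_le (hk.toLp _) (s := Finset.univ)
  rw [hnorm] at this
  simpa only [hinner] using this

lemma integral_norm_sq_eq {f : L2 G} {F : G → ℂ} (h : f =ᵐ[haarProb G] F) :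
    ∫ x, ‖F x‖ ^ 2 ∂haarProb G = ‖f‖ ^ 2 := by
  have h1 : inner ℂ f f = ∫ x, ((‖F x‖ ^ 2 : ℝ) : ℂ) ∂haarProb G := by
    rw [L2.inner_def]
    refine integral_congr_ae ?_
    filter_upwards [h] with x hx
    rw [hx, inner_self_eq_norm_sq_to_K]
    simp
  rw [integral_complex_ofReal, inner_self_eq_norm_sq_to_K] at h1
  exact (Complex.ofReal_injective (by push_cast; exact h1)).symm

instance (μ : Measure G) [IsProbabilityMeasure μ] (l : ℕ) :
    IsProbabilityMeasure (convPow μ l) := by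
  induction l with
  | zero => unfold convPow; infer_instance
  | succ l ih => unfold convPow; infer_instance

lemma convFun_convPow (μ : Measure G) [IsProbabilityMeasure μ] {F : G → ℂ} (hFc : Continuous F)
    {c : ℂ} (h : ∀ x, convFun μ F x = c * F x) (l : ℕ) (x : G) :
    convFun (convPow μ l) F x = c ^ l * F x := by
  induction l generalizing x with
  | zero => simp [convPow, convFun]
  | succ l ih =>
    unfold convPow convFun
    rw [integral_mconv (Continuous.integrable_of_compactSpace (by fun_prop) _)]
    have h1 : ∀ y, ∫ z, F ((y * z)⁻¹ * x) ∂μ = c * F (y⁻¹ * x) := fun y => by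
      rw [← h]
      simp only [convFun, mul_inv_rev, mul_assoc]
    simp only [h1]
    rw [integral_const_mul]
    refine (congrArg _ (ih x)).trans ?_
    ring

lemma convFun_eq_of_eigenvector (μ : Measure G) [IsProbabilityMeasure μ] {N : Subgroup G}
    (hopen : IsOpen (N : Set G)) {f : L2 G} {F : G → ℂ} (hF : RightInv N F)
    (hfF : f =ᵐ[haarProb G] F) {c : ℂ} (h : convOp μ f = c • f) (x : G) :
    convFun μ F x = c * F x := by
  have h1 : convFun μ F =ᵐ[haarProb G] fun x => c * F x := by
    refine (coeFn_convOp_of_ae_eq μ hfF).symm.trans ?_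
    rw [h]
    filter_upwards [Lp.coeFn_smul c f, hfF] with x h1 h2
    rw [h1, Pi.smul_apply, h2, smul_eq_mul]
  have hFc := hF.continuous hopen
  exact congrFun ((Continuous.ae_eq_iff_eq _ ((hF.convFun μ).continuous hopen)
    (by fun_prop)).1 h1) x

/-- The multiplicity of an eigenvalue on `L²(G)^{1_η}` is controlled by the `L²`-norm of
`(μ^{(l)})_η`. -/
lemma card_mul_pow_le (μ : Measure G) [IsProbabilityMeasure μ] {N : Subgroup G} [N.Normal] {η : ℝ}
    (hη : 0 < η) (hN : (N : Set G) = Metric.ball 1 η) {m : ℕ} {f : Fin m → L2 G}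
    (hf : Orthonormal ℂ f) (hmem : ∀ i, f i ∈ invariants (N : Set G)) {c : ℂ}
    (h : ∀ i, convOp μ (f i) = c • f i) (l : ℕ) :
    m * ‖c‖ ^ (2 * l)
      ≤ (eLpNorm (convFun (convPow μ l) (ballDensity η)) 2 (haarProb G)).toReal ^ 2 := by
  have hopen : IsOpen (N : Set G) := hN ▸ Metric.isOpen_ball
  choose F hF hfF using fun i => exists_rightInv_ae_eq hopen (hmem i)
  have hb := sum_norm_sq_convFun_le hη hN (convPow μ l) hf hF hfF
  set B := (eLpNorm (convFun (convPow μ l) (ballDensity η)) 2 (haarProb G)).toReal ^ 2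
  have hc : ∀ i x, ‖convFun (convPow μ l) (F i) x‖ ^ 2 = ‖c‖ ^ (2 * l) * ‖F i x‖ ^ 2 :=
    fun i x => by
      rw [convFun_convPow μ ((hF i).continuous hopen)
        (convFun_eq_of_eigenvector μ hopen (hF i) (hfF i) (h i)), norm_mul, norm_pow]
      ring
  simp only [hc] at hb
  have hint : ∀ i, Integrable (fun x => ‖c‖ ^ (2 * l) * ‖F i x‖ ^ 2) (haarProb G) := fun i => by
    have := (hF i).continuous hopen
    exact Continuous.integrable_of_compactSpace (by fun_prop) _
  -- Integrating the pointwise Bessel bound over `x`, each unit vector `f i` contributes `‖c‖ ^ (2 *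
  -- l)`, while the constant `B` is unchanged because Haar measure has mass one.
  have h1 := integral_mono (integrable_finsetSum _ fun i _ => hint i)
    (integrable_const (μ := haarProb G) B) hb
  rw [integral_finsetSum _ fun i _ => hint i] at h1
  simpa [integral_const_mul, integral_norm_sq_eq (hfF _), hf.1] using h1

/-! ### Eigenvectors with eigenvalue `±1` -/

/-- Expanding the square, `∫∫ |F(y⁻¹x) - e F(x)|² = (1 - 2e² + 1)‖F‖² = 0`. The identity so obtained
for almost every `y` is a closed condition on `y`, hence holds on the support. -/
lemma eq_mul_of_mem_support (μ : Measure G) [IsProbabilityMeasure μ] {F : G → ℂ}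
    (hFc : Continuous F) {e : ℝ} (he : e ^ 2 = 1) (h : ∀ x, convFun μ F x = e * F x) :
    ∀ y ∈ μ.support, ∀ x, F (y⁻¹ * x) = e * F x := by
  have hmp := measurePreserving_div μ
  set P := (haarProb G).prod μ
  have hA : ∫ p, ‖F (p.2⁻¹ * p.1)‖ ^ 2 ∂P = ∫ x, ‖F x‖ ^ 2 ∂haarProb G := by
    conv_rhs => rw [← hmp.map_eq]
    rw [integral_map hmp.measurable.aemeasurable
      (Continuous.aestronglyMeasurable (by fun_prop))]
  have hB : ∫ p : G × G, ‖F p.1‖ ^ 2 ∂P = ∫ x, ‖F x‖ ^ 2 ∂haarProb G := by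
    have := integral_fun_fst (μ := haarProb G) (ν := μ) (fun x => ‖F x‖ ^ 2)
    rw [this]
    simp
  have hC : ∫ p : G × G, (inner ℂ (F p.1) (F (p.2⁻¹ * p.1))).re ∂P
      = e * ∫ x, ‖F x‖ ^ 2 ∂haarProb G := by
    have h1 := integral_inner_convFun μ hFc.memLp_haarProb hFc.memLp_haarProb
    have h2 : ∀ x, inner ℂ (F x) (convFun μ F x) = ((e * ‖F x‖ ^ 2 : ℝ) : ℂ) := fun x => by
      rw [h, ← smul_eq_mul, inner_smul_right, inner_self_eq_norm_sq_to_K]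
      simp
    simp only [h2] at h1
    rw [integral_complex_ofReal, integral_const_mul] at h1
    have h3 := congrArg Complex.re h1
    rw [Complex.ofReal_re] at h3
    rw [h3]
    have hi : Integrable (fun p : G × G => inner ℂ (F p.1) (F (p.2⁻¹ * p.1))) P :=
      Continuous.integrable_of_compactSpace (by fun_prop) _
    exact integral_re hi
  have hD : ∀ p : G × G, ‖F (p.2⁻¹ * p.1) - e * F p.1‖ ^ 2 = ‖F (p.2⁻¹ * p.1)‖ ^ 2
      - 2 * e * (inner ℂ (F p.1) (F (p.2⁻¹ * p.1))).re + ‖F p.1‖ ^ 2 := fun p => by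
    have h1 := norm_sub_sq (𝕜 := ℂ) (F (p.2⁻¹ * p.1)) ((e : ℂ) * F p.1)
    have h2 : RCLike.re (inner ℂ (F (p.2⁻¹ * p.1)) ((e : ℂ) * F p.1))
        = e * (inner ℂ (F p.1) (F (p.2⁻¹ * p.1))).re := by
      rw [inner_re_symm, ← smul_eq_mul, inner_smul_left, Complex.conj_ofReal]
      simp
    rw [h1, h2, norm_mul, mul_pow, Complex.norm_real, Real.norm_eq_abs, sq_abs, he]
    ring
  have hcont : Continuous fun p : G × G => ‖F (p.2⁻¹ * p.1) - e * F p.1‖ ^ 2 := by fun_prop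
  have hzero : ∫ p, ‖F (p.2⁻¹ * p.1) - e * F p.1‖ ^ 2 ∂P = 0 := by
    simp only [hD]
    rw [integral_add, integral_sub, integral_const_mul, hA, hB, hC]
    · linear_combination (-2 * ∫ x, ‖F x‖ ^ 2 ∂haarProb G) * he
    all_goals
      refine Continuous.integrable_of_compactSpace ?_ _
      fun_prop
  rw [integral_eq_zero_iff_of_nonneg (fun p => by positivity)
    (Continuous.integrable_of_compactSpace hcont _)] at hzero
  have hprod : ∀ᵐ p ∂P, F (p.2⁻¹ * p.1) = e * F p.1 := by
    filter_upwards [hzero] with p hp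
    exact sub_eq_zero.1 (norm_eq_zero.1 (pow_eq_zero_iff two_ne_zero |>.1 hp))
  have hmeas : MeasurableSet {p : G × G | F (p.2⁻¹ * p.1) = e * F p.1} :=
    (isClosed_eq (by fun_prop) (by fun_prop)).measurableSet
  have hswap : ∀ᵐ y ∂μ, ∀ᵐ x ∂haarProb G, F (y⁻¹ * x) = e * F x :=
    (Measure.ae_ae_comm (p := fun x y => F (y⁻¹ * x) = e * F x) hmeas).1
      (Measure.ae_ae_of_ae_prod hprod)
  have hcl : IsClosed {y : G | ∀ x, F (y⁻¹ * x) = e * F x} := by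
    simp only [Set.ofPred_forall]
    exact isClosed_iInter fun x => isClosed_eq (by fun_prop) (by fun_prop)
  refine fun y hy => Measure.support_subset_of_isClosed hcl ?_ hy
  filter_upwards [hswap] with y hy
  exact congrFun ((Continuous.ae_eq_iff_eq (haarProb G) (by fun_prop) (by fun_prop)).1 hy)

lemma mem_L2Zero_iff {f : L2 G} : f ∈ L2Zero G ↔ ∫ x, f x ∂haarProb G = 0 := Iff.rfl

lemma eq_zero_of_const {f : L2 G} {F : G → ℂ} (hfF : f =ᵐ[haarProb G] F) (hf : f ∈ L2Zero G)
    (h : ∀ x, F x = F 1) : f = 0 := by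
  rw [mem_L2Zero_iff, integral_congr_ae hfF] at hf
  simp only [h] at hf
  rw [integral_const, probReal_univ, one_smul] at hf
  refine Lp.ext (hfF.trans ?_)
  filter_upwards [Lp.coeFn_zero ℂ 2 (haarProb G)] with x hx
  rw [h, hf, hx, Pi.zero_apply]

/-- A non-zero vector of `L²₀(G)` invariant under an open subgroup is not fixed by `T_μ`. -/
lemma eigenvalue_ne_one (μ : Measure G) [IsProbabilityMeasure μ]
    (hdense : Dense (Subgroup.closure μ.support : Set G)) {N : Subgroup G}
    (hopen : IsOpen (N : Set G)) {f : L2 G} (hf : f ∈ invariants (N : Set G))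
    (hf0 : f ∈ L2Zero G) (hne : f ≠ 0) : convOp μ f ≠ (1 : ℂ) • f := by
  intro h
  obtain ⟨F, hF, hfF⟩ := exists_rightInv_ae_eq hopen hf
  have hFc := hF.continuous hopen
  have hs := eq_mul_of_mem_support μ hFc (e := 1) (by norm_num) fun x => by
    simpa using convFun_eq_of_eigenvector μ hopen hF hfF h x
  -- The left stabilizer of `F`: closed since `F` is continuous, and containing the support, so by
  -- density it is all of `G`. Then `F` is a constant of mean zero.
  let S : Subgroup G :=
    { carrier := {g | ∀ x, F (g * x) = F x}
      one_mem' := fun x => by rw [one_mul]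
      mul_mem' := fun {g g'} hg hg' x => by rw [mul_assoc, hg, hg']
      inv_mem' := fun {g} hg x => by rw [← hg (g⁻¹ * x), mul_inv_cancel_left] }
  have hcl : IsClosed (S : Set G) := by
    change IsClosed {g | ∀ x, F (g * x) = F x}
    simp only [Set.ofPred_forall]
    exact isClosed_iInter fun x => isClosed_eq (by fun_prop) (by fun_prop)
  have hle : Subgroup.closure μ.support ≤ S := (Subgroup.closure_le S).2 fun y hy =>
    inv_inv y ▸ S.inv_mem fun x => by simpa using hs y hy x
  have hall : ∀ g, g ∈ S := fun g => closure_minimal hle hcl (hdense g)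
  exact hne (eq_zero_of_const hfF hf0 fun x => by simpa using hall x 1)

/-- If the support of `μ` meets every open subgroup of index two, then `-1` is not an eigenvalue of
`T_μ` on the vectors invariant under an open normal subgroup. -/
lemma eigenvalue_ne_neg_one (μ : Measure G) [IsProbabilityMeasure μ]
    (hdense : Dense (Subgroup.closure μ.support : Set G))
    (hmeet : ∀ N : Subgroup G, IsOpen (N : Set G) → N.index = 2 → (μ.support ∩ N).Nonempty)
    {N : Subgroup G} [N.Normal] (hopen : IsOpen (N : Set G)) {f : L2 G}
    (hf : f ∈ invariants (N : Set G)) (hne : f ≠ 0) : convOp μ f ≠ (-1 : ℂ) • f := by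
  intro h
  obtain ⟨F, hF, hfF⟩ := exists_rightInv_ae_eq hopen hf
  have hFc := hF.continuous hopen
  have hs := eq_mul_of_mem_support μ hFc (e := -1) (by norm_num) fun x => by
    simpa using convFun_eq_of_eigenvector μ hopen hF hfF h x
  simp only [Complex.ofReal_neg, Complex.ofReal_one, neg_mul, one_mul] at hs
  obtain ⟨x₀, hx₀⟩ : ∃ x, F x ≠ 0 := by
    by_contra! h0
    refine hne (Lp.ext (hfF.trans ?_))
    filter_upwards [Lp.coeFn_zero ℂ 2 (haarProb G)] with x hx
    rw [h0, hx, Pi.zero_apply]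
  let S : Subgroup G :=
    { carrier := {g | ∀ x, F (g * x) = F x}
      one_mem' := fun x => by rw [one_mul]
      mul_mem' := fun {g g'} hg hg' x => by rw [mul_assoc, hg, hg']
      inv_mem' := fun {g} hg x => by rw [← hg (g⁻¹ * x), mul_inv_cancel_left] }
  -- The stabilizer of `F` up to sign is closed and contains the support, so it is all of `G`. The
  -- true stabilizer `S` is open, as it contains `N`, and elements of the support change the sign of
  -- `F ≠ 0`; hence `S` has index exactly two and misses the support.
  let S' : Subgroup G :=
    { carrier := {g | (∀ x, F (g * x) = F x) ∨ ∀ x, F (g * x) = -F x}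
      one_mem' := Or.inl fun x => by rw [one_mul]
      mul_mem' := by
        rintro g g' (hg | hg) (hg' | hg')
        · exact Or.inl fun x => by rw [mul_assoc, hg, hg']
        · exact Or.inr fun x => by rw [mul_assoc, hg, hg']
        · exact Or.inr fun x => by rw [mul_assoc, hg, hg']
        · exact Or.inl fun x => by rw [mul_assoc, hg, hg', neg_neg]
      inv_mem' := by
        rintro g (hg | hg)
        · exact Or.inl fun x => by rw [← hg (g⁻¹ * x), mul_inv_cancel_left]
        · exact Or.inr fun x => by
            have := hg (g⁻¹ * x)
            rw [mul_inv_cancel_left] at this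
            rw [this, neg_neg] }
  have hcl : IsClosed (S' : Set G) := by
    change IsClosed {g | (∀ x, F (g * x) = F x) ∨ ∀ x, F (g * x) = -F x}
    simp only [Set.ofPred_or, Set.ofPred_forall]
    exact (isClosed_iInter fun x => isClosed_eq (by fun_prop) (by fun_prop)).union
      (isClosed_iInter fun x => isClosed_eq (by fun_prop) (by fun_prop))
  have hle : Subgroup.closure μ.support ≤ S' := (Subgroup.closure_le S').2 fun y hy =>
    inv_inv y ▸ S'.inv_mem (Or.inr (hs y hy))
  have hall : ∀ g, g ∈ S' := fun g => closure_minimal hle hcl (hdense g)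
  have hNS : N ≤ S := fun n hn x => hF.left x n hn
  have hSopen : IsOpen (S : Set G) := S.isOpen_of_mem_nhds
    (mem_of_superset (hopen.mem_nhds N.one_mem) hNS)
  have hnotS : ∀ g, (∀ x, F (g * x) = -F x) → g ∉ S := fun g hg hgS =>
    hx₀ (self_eq_neg.1 ((hgS x₀).symm.trans (hg x₀)))
  obtain ⟨y, hy⟩ := Measure.nonempty_support (IsProbabilityMeasure.ne_zero μ)
  have hindex : S.index = 2 := by
    refine Subgroup.index_eq_two_iff.2 ⟨y⁻¹, fun b => ?_⟩
    rcases hall b with hb | hb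
    · exact Or.inr ⟨hb, hnotS _ fun x => by rw [mul_assoc, hb, hs y hy]⟩
    · exact Or.inl ⟨fun x => by rw [mul_assoc, hb, hs y hy, neg_neg], hnotS b hb⟩
  obtain ⟨z, hz, hzS⟩ := hmeet S hSopen hindex
  exact hnotS _ (hs z hz) (S.inv_mem hzS)

end

section

variable {G : Type*} [Group G] [MetricSpace G] [IsTopologicalGroup G] [CompactSpace G]
  [MeasurableSpace G] [BorelSpace G]

/-! ### Subrepresentations of the right regular representation -/

/-- The restriction of a right translation to an invariant subspace. -/
def rightTransRestrict (V : Submodule ℂ (L2 G)) (hV : ∀ g, ∀ v ∈ V, rightTrans g v ∈ V) (g : G) :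
    V ≃ₗᵢ[ℂ] V where
  toFun v := ⟨rightTrans g v, hV g v v.2⟩
  map_add' v w := Subtype.ext (map_add (rightTrans g) (v : L2 G) w)
  map_smul' c v := Subtype.ext (map_smul (rightTrans g) c (v : L2 G))
  invFun v := ⟨rightTrans g⁻¹ v, hV g⁻¹ v v.2⟩
  left_inv v := Subtype.ext (by
    change rightTrans g⁻¹ (rightTrans g (v : L2 G)) = v
    rw [← rightTrans_mul, inv_mul_cancel, rightTrans_one])
  right_inv v := Subtype.ext (by
    change rightTrans g (rightTrans g⁻¹ (v : L2 G)) = v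
    rw [← rightTrans_mul, mul_inv_cancel, rightTrans_one])
  norm_map' v := (rightTrans g).norm_map v

lemma continuous_rightTrans : Continuous fun p : G × L2 G => rightTrans p.1 p.2 := by
  let g : G × L2 G → C(G, G) := fun p => ⟨fun x => x * p.1, continuous_mul_const p.1⟩
  have hg : Continuous g := ContinuousMap.continuous_of_continuous_uncurry _ (by
    change Continuous fun q : (G × L2 G) × G => q.2 * q.1.1
    fun_prop)
  exact Continuous.compMeasurePreservingLp (f := Prod.snd) continuous_snd hg
    (fun p => measurePreserving_mul_right (haarProb G) p.1) (by norm_num)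

/-- An invariant subspace of `L²(G)`, as a unitary representation by right translations. -/
def subRep (V : Submodule ℂ (L2 G)) [CompleteSpace V]
    (hV : ∀ g, ∀ v ∈ V, rightTrans g v ∈ V) : UnitaryRep G V where
  toHom := Unitary.linearIsometryEquiv.symm.toMonoidHom.comp
    { toFun := rightTransRestrict V hV
      map_one' := LinearIsometryEquiv.ext fun v => Subtype.ext (rightTrans_one (v : L2 G))
      map_mul' := fun g h =>
        LinearIsometryEquiv.ext fun v => Subtype.ext (rightTrans_mul g h (v : L2 G)) }
  continuous_action := by
    refine Continuous.subtype_mk (f := fun p : G × V => rightTrans p.1 (p.2 : L2 G)) ?_ _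
    exact continuous_rightTrans.comp (continuous_fst.prodMk continuous_snd.subtype_val)

lemma coe_subRep_apply (V : Submodule ℂ (L2 G)) [CompleteSpace V]
    (hV : ∀ g, ∀ v ∈ V, rightTrans g v ∈ V) (g : G) (v : V) :
    (((subRep V hV).toHom g : V →L[ℂ] V) v : L2 G) = rightTrans g (v : L2 G) := rfl

/-- A non-zero finite-dimensional invariant subspace contains an irreducible one. -/
lemma exists_irreducible_le (E : Submodule ℂ (L2 G)) [FiniteDimensional ℂ E] (hE : E ≠ ⊥)
    (hinv : ∀ g, ∀ v ∈ E, rightTrans g v ∈ E) :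
    ∃ (V : Submodule ℂ (L2 G)) (_ : FiniteDimensional ℂ V) (_ : CompleteSpace V)
      (hV : ∀ g, ∀ v ∈ V, rightTrans g v ∈ V),
      V ≤ E ∧ V ≠ ⊥ ∧ (subRep V hV).Irreducible := by
  let S : Set (Submodule ℂ (L2 G)) :=
    {V | V ≤ E ∧ V ≠ ⊥ ∧ ∀ g, ∀ v ∈ V, rightTrans g v ∈ V}
  -- A non-zero invariant subspace of least dimension; any non-zero subrepresentation, viewed in
  -- `L²(G)`, competes with it and so has full dimension.
  obtain ⟨V, ⟨hVE, hV0, hV⟩, hmin⟩ :=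
    (measure fun V : Submodule ℂ (L2 G) => Module.finrank ℂ V).wf.has_min S ⟨E, le_rfl, hE, hinv⟩
  have hfin : FiniteDimensional ℂ V := Submodule.finiteDimensional_of_le hVE
  have hcomp : CompleteSpace V := FiniteDimensional.complete ℂ V
  refine ⟨V, hfin, hcomp, hV, hVE, hV0, Submodule.nontrivial_iff_ne_bot.2 hV0, fun W hW => ?_⟩
  by_cases hW0 : W = ⊥
  · exact Or.inl hW0
  refine Or.inr (Submodule.eq_top_of_finrank_eq (le_antisymm (Submodule.finrank_le W) ?_))
  have hle : W.map V.subtype ≤ V := Submodule.map_subtype_le V W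
  have h := hmin (W.map V.subtype) ⟨hle.trans hVE, ?_, ?_⟩
  · have h2 : Module.finrank ℂ (W.map V.subtype) = Module.finrank ℂ W :=
      Submodule.finrank_map_subtype_eq V W
    rw [← h2]
    exact not_lt.1 h
  · intro h
    refine hW0 (Submodule.map_injective_of_injective V.injective_subtype ?_)
    rw [h, Submodule.map_bot]
  · rintro g _ ⟨w, hw, rfl⟩
    exact ⟨_, hW g w hw, coe_subRep_apply V hV g w⟩

end

section

variable {G : Type u} [Group G] [MetricSpace G] [IsTopologicalGroup G] [CompactSpace G]
  [MeasurableSpace G] [BorelSpace G]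

/-- An eigenvector of `T_μ` orthogonal to `L²(G)^{1_η}` generates an eigenspace of large
dimension. -/
lemma exists_orthonormal_eigenvectors {L C₀ : ℝ} (hLR : IsLocallyRandom G L C₀)
    (μ : Measure G) [IsProbabilityMeasure μ] {N N' : Subgroup G} [N.Normal] [N'.Normal]
    {η : ℝ} (hN : (N : Set G) = Metric.ball 1 η) (hN' : IsOpen (N' : Set G))
    {f : L2 G} (hf : f ∈ invariants (N' : Set G)) (hf' : f ∈ (invariants (N : Set G))ᗮ)
    (hne : f ≠ 0) {c : ℂ} (hc : convOp μ f = c • f) :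
    ∃ (m : ℕ) (v : Fin m → L2 G), Orthonormal ℂ v ∧ (∀ i, v i ∈ invariants (N' : Set G)) ∧
      (∀ i, convOp μ (v i) = c • v i) ∧ 0 < m ∧ 1 ≤ C₀ * (m : ℝ) ^ L * η := by
  -- The `c`-eigenspace inside `L²(G)^{N'} ⊖ L²(G)^N`. Normality of `N` and `N'` makes it stable
  -- under right translations.
  let E : Submodule ℂ (L2 G) := invariants (N' : Set G) ⊓ (invariants (N : Set G))ᗮ ⊓
    LinearMap.ker ((convOp μ : L2 G →ₗ[ℂ] L2 G) - c • LinearMap.id)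
  have hmemE : ∀ v, v ∈ E ↔ (v ∈ invariants (N' : Set G) ∧ v ∈ (invariants (N : Set G))ᗮ) ∧
      convOp μ v = c • v := fun v => by
    simp [E, sub_eq_zero]
  have hfd := finiteDimensional_invariants hN'
  have : FiniteDimensional ℂ E :=
    Submodule.finiteDimensional_of_le (inf_le_left.trans inf_le_left : E ≤ _)
  obtain ⟨V, hfin, hcomp, hV, hVE, hV0, hirr⟩ := exists_irreducible_le E
    (fun h => hne ((Submodule.eq_bot_iff _).1 h f ((hmemE f).2 ⟨⟨hf, hf'⟩, hc⟩)))
    (fun g v hv => by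
      obtain ⟨⟨h1, h2⟩, h3⟩ := (hmemE v).1 hv
      exact (hmemE _).2 ⟨⟨rightTrans_mem_invariants h1 g,
        rightTrans_mem_invariants_orthogonal h2 g⟩, by rw [convOp_rightTrans, h3, map_smul]⟩)
  let b := stdOrthonormalBasis ℂ V
  have hbE : ∀ i, (b i : L2 G) ∈ E := fun i => hVE (b i).2
  refine ⟨Module.finrank ℂ V, fun i => b i,
    b.orthonormal.comp_linearIsometry V.subtypeₗᵢ, fun i => ((hmemE _).1 (hbE i)).1.1,
    fun i => ((hmemE _).1 (hbE i)).2, Submodule.one_le_finrank_iff.2 hV0, ?_⟩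
  by_contra! hlt
  have hC₀ := hLR.one_le_C₀
  have hnear : ∀ x ∈ N, ∀ v ∈ V,
      ‖rightTrans x v - v‖ ≤ C₀ * (Module.finrank ℂ V : ℝ) ^ L * η * ‖v‖ := fun x hx v hv => by
    have h1 := hLR.norm_sub_le V (subRep V hV) hirr x 1
    have h2 : dist x 1 ≤ η := by
      have : x ∈ (N : Set G) := hx
      rw [hN] at this
      exact (Metric.mem_ball.1 this).le
    have h3 := ContinuousLinearMap.le_of_opNorm_le _
      (h1.trans (mul_le_mul_of_nonneg_left h2 (by positivity))) ⟨v, hv⟩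
    rw [map_one] at h3
    exact h3
  refine hV0 ((Submodule.eq_bot_iff _).2 fun v hv => ?_)
  -- All powers of `x` stay in the group `N`, so the displacement bound holds for every iterate and
  -- `x` acts trivially on `V`. But `V` is orthogonal to the `N`-invariant vectors.
  have hvN : v ∈ invariants (N : Set G) := mem_invariants_iff.2 fun x hx =>
    eq_of_forall_norm_iterate_sub_le (rightTrans x) _ hlt V (hV x)
      (fun n w hw => by rw [← rightTrans_pow]; exact hnear _ (N.pow_mem hx n) w hw) v hv
  exact inner_self_eq_zero.1 (((hmemE v).1 (hVE hv)).1.2 v hvN)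

end

section

variable {G : Type*} [Group G] [MetricSpace G] [IsTopologicalGroup G] [CompactSpace G]
  [MeasurableSpace G] [BorelSpace G]

/-! ### Entropy -/

lemma IsBiInvariantMetric.ball_eq_preimage (hbi : IsBiInvariantMetric G) (x : G) (η : ℝ) :
    Metric.ball x η = (fun y => x⁻¹ * y) ⁻¹' Metric.ball 1 η := by
  ext y
  have h := (hbi x (x⁻¹ * y) 1).1
  rw [mul_inv_cancel_left, mul_one] at h
  rw [Set.mem_preimage, Metric.mem_ball, Metric.mem_ball, h]

lemma IsBiInvariantMetric.normal (hbi : IsBiInvariantMetric G) {N : Subgroup G} {η : ℝ}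
    (hN : (N : Set G) = Metric.ball 1 η) : N.Normal := by
  refine ⟨fun n hn g => ?_⟩
  rw [← SetLike.mem_coe, hN, Metric.mem_ball] at hn ⊢
  have h1 := (hbi g⁻¹ (g * n) g).2
  have h2 := (hbi g n 1).1
  rw [mul_inv_cancel] at h1
  rw [mul_one] at h2
  rwa [h1, h2]

/-- Balls of radius `η` are the cosets of `N`, so the covering number is the index of `N`, the
reciprocal of `|1_η|`: coset representatives give a cover, and comparing measures shows none is
smaller. -/
lemma metricEntropy_univ (hbi : IsBiInvariantMetric G) {N : Subgroup G} {η : ℝ}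
    (hN : (N : Set G) = Metric.ball 1 η) :
    metricEntropy (Set.univ : Set G) η
      = Real.log (1 / (haarProb G).real (Metric.ball (1 : G) η)) := by
  have hopen : IsOpen (N : Set G) := hN ▸ Metric.isOpen_ball
  have : Finite (G ⧸ N) := N.quotient_finite_of_isOpen hopen
  have : N.FiniteIndex := N.finiteIndex_of_finite_quotient
  have hpos : 0 < (haarProb G).real (Metric.ball (1 : G) η) := hN ▸ haarProb_real_pos hopen
  have hidx : (N.index : ℝ) * (haarProb G).real (Metric.ball (1 : G) η) = 1 := by
    have h := congrArg ENNReal.toReal (N.index_mul_measure hopen.measurableSet (haarProb G))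
    rw [hN] at h
    simpa [measureReal_def] using h
  have hball : ∀ x, (haarProb G).real (Metric.ball x η)
      = (haarProb G).real (Metric.ball (1 : G) η) := fun x => by
    rw [hbi.ball_eq_preimage, measureReal_def, measure_preimage_mul, measureReal_def]
  have hle : ∀ t : Finset G, Set.univ ⊆ ⋃ x ∈ t, Metric.ball x η → N.index ≤ t.card :=
    fun t ht => by
      have h1 : (haarProb G).real Set.univ ≤ ∑ x ∈ t, (haarProb G).real (Metric.ball x η) :=
        (measureReal_mono ht (measure_ne_top _ _)).trans (measureReal_biUnion_finset_le t _)
      simp only [hball, Finset.sum_const, nsmul_eq_mul, probReal_univ] at h1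
      rw [← hidx] at h1
      exact_mod_cast le_of_mul_le_mul_right h1 hpos
  have hmem : N.index ∈ {n : ℕ | ∃ t : Finset G, (t : Set G) ⊆ Set.univ ∧
      Set.univ ⊆ ⋃ x ∈ t, Metric.ball x η ∧ t.card = n} := by
    have := Fintype.ofFinite (G ⧸ N)
    have hinj : Function.Injective (Quotient.out : G ⧸ N → G) := Quotient.out_injective
    refine ⟨Finset.univ.map ⟨_, hinj⟩, Set.subset_univ _, fun y _ => ?_, ?_⟩
    · simp only [Finset.mem_map, Finset.mem_univ, true_and, Function.Embedding.coeFn_mk,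
        Set.mem_iUnion, exists_prop, exists_exists_eq_and]
      refine ⟨QuotientGroup.mk y, ?_⟩
      rw [hbi.ball_eq_preimage, ← hN]
      exact QuotientGroup.eq.1 (QuotientGroup.out_eq' _)
    · rw [Finset.card_map, Finset.card_univ, Subgroup.index, Nat.card_eq_fintype_card]
      rfl
  have hcov : coverNum (Set.univ : Set G) η = N.index := by
    refine le_antisymm (Nat.sInf_le hmem) (le_csInf ⟨_, hmem⟩ ?_)
    rintro n ⟨t, -, ht, rfl⟩
    exact hle t ht
  rw [metricEntropy, hcov, eq_one_div_of_mul_eq_one_left hidx]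

/-! ### Spectral gaps -/

lemma le_gap (μ : Measure G) [IsProbabilityMeasure μ] {K : Submodule ℂ (L2 G)} {r : ℝ}
    (hr : 0 < r) (h : ∀ f ∈ K, ‖convOp μ f‖ ≤ r * ‖f‖) :
    ((-Real.log r : ℝ) : EReal) ≤ gap μ K := by
  have h1 : ‖(convOp μ).comp K.subtypeL‖ ≤ r :=
    ContinuousLinearMap.opNorm_le_bound _ hr.le fun f => h f f.2
  have h2 : ‖(convOp μ).comp K.subtypeL‖ₑ ≤ ENNReal.ofReal r := by
    rw [← ofReal_norm]
    exact ENNReal.ofReal_le_ofReal h1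
  rw [gap, EReal.coe_neg, EReal.neg_le_neg_iff, ← ENNReal.log_ofReal_of_pos hr]
  exact ENNReal.log_monotone h2

/-- By symmetry `T` also preserves `Kᗮ`. Consequently the projection of an eigenvector, if non-zero,
is an eigenvector with the same eigenvalue. -/
lemma starProjection_comm_of_isSymmetric {E : Type*} [NormedAddCommGroup E]
    [InnerProductSpace ℂ E] (T : E →L[ℂ] E) (hT : (T : E →ₗ[ℂ] E).IsSymmetric)
    (K : Submodule ℂ E) [K.HasOrthogonalProjection] (hK : ∀ v ∈ K, T v ∈ K) (f : E) :
    K.starProjection (T f) = T (K.starProjection f) := by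
  refine Submodule.eq_starProjection_of_mem_of_inner_eq_zero
    (hK _ (Submodule.starProjection_apply_mem K f)) fun w hw => ?_
  rw [← map_sub]
  refine (hT (f - K.starProjection f) w).trans ?_
  exact Submodule.starProjection_inner_eq_zero f _ (hK w hw)

/-- If every eigenvalue of a symmetric operator on the successive differences of an exhausting
chain of finite-dimensional invariant subspaces, from `H i₀` on, is at most `r` in absolute value,
then the operator is bounded by `r` on the orthogonal complement of `H i₀`. -/
lemma norm_map_le_of_chain {E : Type*} [NormedAddCommGroup E] [InnerProductSpace ℂ E]
    (T : E →L[ℂ] E) (hT : (T : E →ₗ[ℂ] E).IsSymmetric)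
    (H : ℕ → Submodule ℂ E) [∀ i, FiniteDimensional ℂ (H i)] (hmono : Monotone H)
    (hdense : ⊤ ≤ (⨆ i, H i).topologicalClosure) (hH : ∀ i, ∀ v ∈ H i, T v ∈ H i)
    {r : ℝ} (hr : 0 ≤ r) (i₀ : ℕ)
    (h : ∀ i ≥ i₀, ∀ (l : ℝ), ∀ v ∈ H (i + 1), v ∈ (H i)ᗮ → v ≠ 0 →
      T v = (l : ℂ) • v → |l| ≤ r) :
    ∀ f ∈ (H i₀)ᗮ, ‖T f‖ ≤ r * ‖f‖ := by
  have hcomm := fun i => starProjection_comm_of_isSymmetric T hT (H i) (hH i)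
  have hstep : ∀ j, ∀ f ∈ H j ⊓ (H i₀)ᗮ, ‖T f‖ ≤ r * ‖f‖ := by
    intro j
    have : FiniteDimensional ℂ (H j ⊓ (H i₀)ᗮ : Submodule ℂ E) :=
      Submodule.finiteDimensional_of_le inf_le_left
    refine norm_map_le_of_abs_eigenvalue_le T hT (H j ⊓ (H i₀)ᗮ) (fun v hv => ⟨hH j v hv.1, ?_⟩) hr ?_
    · refine (Submodule.mem_orthogonal' _ _).2 fun u hu => ?_
      exact (hT v u).trans ((Submodule.mem_orthogonal' _ _).1 hv.2 _ (hH i₀ u hu))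
    · rintro l v ⟨hvj, hv0⟩ hne hl
      classical
      -- An eigenvector may spread over several levels. At the least `k` where its projection is
      -- non-zero, that projection is an eigenvector in `H k ⊖ H (k - 1)`, and `k > i₀` because `v`
      -- is orthogonal to `H i₀`.
      have hex : ∃ k, (H k).starProjection v ≠ 0 :=
        ⟨j, by rwa [Submodule.starProjection_eq_self_iff.2 hvj]⟩
      have hk := Nat.find_spec hex
      have hmin : ∀ m < Nat.find hex, (H m).starProjection v = 0 := fun m hm =>
        not_not.1 (Nat.find_min hex hm)
      set k := Nat.find hex
      have hzero : ∀ i ≤ i₀, (H i).starProjection v = 0 := fun i hi =>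
        (Submodule.starProjection_apply_eq_zero_iff _).2
          (Submodule.orthogonal_le (hmono hi) hv0)
      have hik : i₀ < k := by
        by_contra! hle
        exact hk (hzero k hle)
      obtain ⟨i, hi⟩ : ∃ i, k = i + 1 := ⟨k - 1, by omega⟩
      rw [hi] at hk
      refine h i (by omega) l _ (Submodule.starProjection_apply_mem _ v) ?_ hk ?_
      · have h1 := hmin i (by omega)
        rw [Submodule.starProjection_apply_eq_zero_iff] at h1
        have h2 : v - (H (i + 1)).starProjection v ∈ (H i)ᗮ :=
          Submodule.orthogonal_le (hmono i.le_succ) (Submodule.sub_starProjection_mem_orthogonal v)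
        simpa using (H i)ᗮ.sub_mem h1 h2
      · rw [← hcomm, hl, map_smul]
  intro f hf
  have hlim := Submodule.starProjection_tendsto_self H hmono f hdense
  refine le_of_tendsto_of_tendsto ((T.continuous.tendsto f).comp hlim).norm
    (hlim.norm.const_mul r) ?_
  filter_upwards [eventually_ge_atTop i₀] with j hj
  refine hstep j _ ⟨Submodule.starProjection_apply_mem _ f, ?_⟩
  have h2 : f - (H j).starProjection f ∈ (H i₀)ᗮ :=
    Submodule.orthogonal_le (hmono hj) (Submodule.sub_starProjection_mem_orthogonal f)
  simpa using (H i₀)ᗮ.sub_mem hf h2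

end

/-! ### Splitting along an invariant subspace -/

section

variable {E : Type*} [NormedAddCommGroup E] [InnerProductSpace ℂ E]

lemma map_mem_orthogonal_of_isSymmetric {T : E →L[ℂ] E} (hT : (T : E →ₗ[ℂ] E).IsSymmetric)
    {H : Submodule ℂ E} (hH : ∀ v ∈ H, T v ∈ H) : ∀ v ∈ Hᗮ, T v ∈ Hᗮ := fun v hv =>
  (Submodule.mem_orthogonal' _ _).2 fun u hu =>
    (hT v u).trans ((Submodule.mem_orthogonal' _ _).1 hv _ (hH u hu))

lemma norm_sq_add_of_mem_orthogonal {H : Submodule ℂ E} {p q : E} (hp : p ∈ H) (hq : q ∈ Hᗮ) :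
    ‖p + q‖ ^ 2 = ‖p‖ ^ 2 + ‖q‖ ^ 2 := by
  have := norm_add_sq_eq_norm_sq_add_norm_sq_of_inner_eq_zero p q (hq p hp)
  linarith

lemma exists_split {H Z : Submodule ℂ E} [H.HasOrthogonalProjection] (hZ : Hᗮ ≤ Z) {f : E}
    (hf : f ∈ Z) : ∃ p ∈ H ⊓ Z, ∃ q ∈ Hᗮ, f = p + q := by
  have hq := Submodule.sub_starProjection_mem_orthogonal (K := H) f
  refine ⟨H.starProjection f, ⟨Submodule.starProjection_apply_mem _ _, ?_⟩, _, hq, by abel⟩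
  simpa using Z.sub_mem hf (hZ hq)

lemma norm_map_le_of_split {T : E →L[ℂ] E} (hT : (T : E →ₗ[ℂ] E).IsSymmetric)
    {H Z : Submodule ℂ E} [H.HasOrthogonalProjection] (hZ : Hᗮ ≤ Z) (hH : ∀ v ∈ H, T v ∈ H)
    {r : ℝ} (hr : 0 ≤ r) (h1 : ∀ v ∈ H ⊓ Z, ‖T v‖ ≤ r * ‖v‖) (h2 : ∀ v ∈ Hᗮ, ‖T v‖ ≤ r * ‖v‖) :
    ∀ f ∈ Z, ‖T f‖ ≤ r * ‖f‖ := by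
  intro f hf
  obtain ⟨p, hp, q, hq, rfl⟩ := exists_split hZ hf
  refine le_of_sq_le_sq ?_ (by positivity)
  rw [map_add, mul_pow, norm_sq_add_of_mem_orthogonal hp.1 hq,
    norm_sq_add_of_mem_orthogonal (hH p hp.1) (map_mem_orthogonal_of_isSymmetric hT hH q hq),
    mul_add, ← mul_pow, ← mul_pow]
  gcongr
  · exact h1 p hp
  · exact h2 q hq

lemma re_inner_map_le_of_split {T : E →L[ℂ] E} (hT : (T : E →ₗ[ℂ] E).IsSymmetric)
    {H Z : Submodule ℂ E} [H.HasOrthogonalProjection] (hZ : Hᗮ ≤ Z) (hH : ∀ v ∈ H, T v ∈ H)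
    {r : ℝ} (h1 : ∀ v ∈ H ⊓ Z, (inner ℂ (T v) v).re ≤ r * ‖v‖ ^ 2)
    (h2 : ∀ v ∈ Hᗮ, (inner ℂ (T v) v).re ≤ r * ‖v‖ ^ 2) :
    ∀ f ∈ Z, (inner ℂ (T f) f).re ≤ r * ‖f‖ ^ 2 := by
  intro f hf
  obtain ⟨p, hp, q, hq, rfl⟩ := exists_split hZ hf
  have h3 : inner ℂ (T p) q = 0 := hq _ (hH p hp.1)
  have h4 : inner ℂ (T q) p = 0 := (Submodule.mem_orthogonal' _ _).1
    (map_mem_orthogonal_of_isSymmetric hT hH q hq) _ hp.1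
  rw [norm_sq_add_of_mem_orthogonal hp.1 hq, map_add, inner_add_left, inner_add_right,
    inner_add_right, h3, h4, add_zero, zero_add, Complex.add_re]
  linarith [h1 p hp, h2 q hq]

end

/-- If `|c|` were larger, the upper estimate would give `L log m ≤ h / (4 d₀ a)`, about a quarter of
`log (1/η)`, whereas `hdim` gives `L log m ≥ log (1/η) - log C₀`. The condition `hlarge` says that
the missing three quarters exceed the constants. Here `h` and `B` belong to the finer scale `η ^ a`,
which is the source of the factor `a`. -/
lemma abs_le_exp_neg_of_multiplicity {L C₀ C₁ C₂ d₀ a η p B h c : ℝ} {m l : ℕ} (hL : 1 ≤ L)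
    (hC₀ : 1 ≤ C₀) (hC₁ : 1 ≤ C₁) (hC₂ : 0 < C₂) (hd₀ : 0 < d₀) (ha : 1 < a) (hη : 0 < η)
    (hm : 0 < m) (hdim : 1 ≤ C₀ * (m : ℝ) ^ L * η) (hmult : m * |c| ^ (2 * l) ≤ B)
    (hent : (1 - 1 / (8 * L * d₀ * a)) * h ≤ h - Real.log B) (hl : l ≤ C₂ * h)
    (hh : h = Real.log (1 / p)) (hp : 1 / C₁ * (η ^ a) ^ d₀ ≤ p)
    (hlarge : Real.log C₀ + Real.log C₁ / (4 * d₀ * a) < 3 / 4 * -Real.log η) :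
    |c| ≤ Real.exp (-(1 / (16 * C₂ * L * d₀ * a))) := by
  have ha0 : 0 < a := by linarith
  have hL0 : 0 < L := by linarith
  have hC₀' : 0 < C₀ := by linarith
  have hC₁' : 0 < C₁ := by linarith
  have hm' : (0 : ℝ) < m := by exact_mod_cast hm
  by_contra! hlt
  set κ := 1 / (16 * C₂ * L * d₀ * a) with hκ
  have hκ0 : 0 < κ := by positivity
  have hc : 0 < |c| := (Real.exp_pos _).trans hlt
  have hlog : -κ < Real.log |c| := (Real.lt_log_iff_exp_lt hc).2 hlt
  have h1 : Real.log m + 2 * l * Real.log |c| ≤ Real.log B := by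
    have := Real.log_le_log (by positivity) hmult
    rw [Real.log_mul hm'.ne' (by positivity), Real.log_pow] at this
    push_cast at this
    exact this
  have h2 : 0 ≤ Real.log C₀ + L * Real.log m + Real.log η := by
    have := Real.log_le_log one_pos hdim
    rwa [Real.log_one, Real.log_mul (by positivity) hη.ne', Real.log_mul hC₀'.ne' (by positivity),
      Real.log_rpow hm'] at this
  have h3 : h ≤ Real.log C₁ + d₀ * (a * -Real.log η) := by
    have := Real.log_le_log (by positivity) hp
    rw [Real.log_mul (by positivity) (by positivity), Real.log_rpow (by positivity),
      Real.log_rpow hη, one_div, Real.log_inv] at this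
    rw [hh, one_div, Real.log_inv]
    linarith
  have h4 : (l : ℝ) * κ ≤ C₂ * h * κ := mul_le_mul_of_nonneg_right hl hκ0.le
  have h5 : -(l * κ) ≤ l * Real.log |c| := by
    have : (0 : ℝ) ≤ l := Nat.cast_nonneg l
    nlinarith
  -- The entropy deficit contributes `1/8` and the time factor `2 C₂ κ` contributes `2/16`, in units
  -- of `h / (L d₀ a)`.
  have h6 : Real.log m ≤ h / (4 * L * d₀ * a) := by
    have e : 1 / (8 * L * d₀ * a) * h + 2 * (C₂ * h * κ) = h / (4 * L * d₀ * a) := by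
      rw [hκ]
      field_simp
      ring
    linarith
  have h7 : L * Real.log m ≤ h / (4 * d₀ * a) := by
    calc L * Real.log m ≤ L * (h / (4 * L * d₀ * a)) := by gcongr
      _ = _ := by field_simp
  have h8 : h / (4 * d₀ * a) ≤ Real.log C₁ / (4 * d₀ * a) + 1 / 4 * -Real.log η := by
    have e : Real.log C₁ / (4 * d₀ * a) + 1 / 4 * -Real.log η
        = (Real.log C₁ + d₀ * (a * -Real.log η)) / (4 * d₀ * a) := by
      field_simp
    rw [e]
    gcongr
  linarith

/-! ### Functions of mean zero, and contractivity -/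

section

variable {G : Type*} [Group G] [MetricSpace G] [IsTopologicalGroup G] [CompactSpace G]
  [MeasurableSpace G] [BorelSpace G]

lemma mem_L2Zero_iff_inner {f : L2 G} (hm : MemLp (fun _ : G => (1 : ℂ)) 2 (haarProb G)) :
    f ∈ L2Zero G ↔ inner ℂ (hm.toLp _) f = 0 := by
  rw [mem_L2Zero_iff, L2.inner_def]
  have : ∫ x, f x ∂haarProb G = ∫ x, inner ℂ (hm.toLp _ x) (f x) ∂haarProb G := by
    refine integral_congr_ae ?_
    filter_upwards [hm.coeFn_toLp] with x hx
    rw [hx, RCLike.inner_apply, map_one, mul_one]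
  rw [this]

lemma orthogonal_invariants_le_L2Zero (S : Set G) : (invariants S)ᗮ ≤ L2Zero G := by
  intro f hf
  have hm := (continuous_const (y := (1 : ℂ)) : Continuous fun _ : G => (1 : ℂ)).memLp_haarProb
  refine (mem_L2Zero_iff_inner hm).2 (hf _ (invariants_anti (Set.subset_univ S) ?_))
  simpa using RightInv.toLp_mem_invariants (N := ⊤) (fun _ _ _ => rfl) hm

lemma convOp_mem_L2Zero (μ : Measure G) [IsProbabilityMeasure μ]
    (hsymm : μ.map (fun x => x⁻¹) = μ) {f : L2 G} (hf : f ∈ L2Zero G) :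
    convOp μ f ∈ L2Zero G := by
  have hm := (continuous_const (y := (1 : ℂ)) : Continuous fun _ : G => (1 : ℂ)).memLp_haarProb
  rw [mem_L2Zero_iff_inner hm] at hf ⊢
  have h1 : convOp μ (hm.toLp _) = hm.toLp _ := by
    refine Lp.ext ((coeFn_convOp_of_ae_eq μ hm.coeFn_toLp).trans ?_)
    filter_upwards [hm.coeFn_toLp] with x hx
    rw [hx]
    simp [convFun]
  rw [← hf]
  conv_rhs => rw [← h1]
  exact (isSymmetric_convOp μ hsymm (hm.toLp _) f).symm

lemma abs_eigenvalue_le_one (μ : Measure G) [IsProbabilityMeasure μ] {f : L2 G} (hne : f ≠ 0)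
    {l : ℝ} (h : convOp μ f = (l : ℂ) • f) : |l| ≤ 1 := by
  have h1 := norm_convOp_le μ f
  rw [h, norm_smul, Complex.norm_real, Real.norm_eq_abs] at h1
  exact le_of_mul_le_mul_right (h1.trans (one_mul _).ge) (norm_pos_iff.2 hne)

end

/-! ### Eigenvalue bound at a single scale -/

section

variable {G : Type u} [Group G] [MetricSpace G] [IsTopologicalGroup G] [CompactSpace G]
  [MeasurableSpace G] [BorelSpace G]

/-- The eigenvalues of `T_μ` on `L²(G)^{1_{η^a}} ⊖ L²(G)^{1_η}` for a small scale `η`. -/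
lemma abs_eigenvalue_le (hbi : IsBiInvariantMetric G)
    (hball : ∀ η : ℝ, 0 < η → ∃ N : Subgroup G, (N : Set G) = Metric.ball (1 : G) η)
    {L C₀ C₁ d₀ : ℝ} (hLR : IsLocallyRandom G L C₀) (hDC : DimensionCondition G C₁ d₀)
    (μ : Measure G) [IsProbabilityMeasure μ] {a C₂ η : ℝ} (ha : 1 < a) (hC₂ : 0 < C₂)
    (hη : 0 < η) (hη' : η < 1) {l : ℕ}
    (hl : (l : ℝ) ≤ C₂ * metricEntropy (Set.univ : Set G) (η ^ a))
    (hent : (1 - 1 / (8 * L * d₀ * a)) * metricEntropy (Set.univ : Set G) (η ^ a)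
      ≤ renyiEntropy (convPow μ l) (η ^ a))
    (hlarge : Real.log C₀ + Real.log C₁ / (4 * d₀ * a) < 3 / 4 * -Real.log η)
    {c : ℝ} {f : L2 G} (hf : f ∈ invariants (Metric.ball (1 : G) (η ^ a)))
    (hf' : f ∈ (invariants (Metric.ball (1 : G) η))ᗮ) (hne : f ≠ 0)
    (hc : convOp μ f = (c : ℂ) • f) : |c| ≤ Real.exp (-(1 / (16 * C₂ * L * d₀ * a))) := by
  have hηa : 0 < η ^ a := Real.rpow_pos_of_pos hη a
  obtain ⟨N, hN⟩ := hball η hη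
  obtain ⟨N', hN'⟩ := hball (η ^ a) hηa
  have := hbi.normal hN
  have := hbi.normal hN'
  have hopen' : IsOpen (N' : Set G) := hN' ▸ Metric.isOpen_ball
  rw [← hN'] at hf
  rw [← hN] at hf'
  obtain ⟨m, v, hv, hvN, hvc, hm, hdim⟩ :=
    exists_orthonormal_eigenvectors hLR μ hN hopen' hf hf' hne hc
  have hmult := card_mul_pow_le μ hηa hN' hv hvN hvc l
  rw [Complex.norm_real, Real.norm_eq_abs] at hmult
  have hh := metricEntropy_univ hbi hN'
  rw [renyiEntropy, ← hh] at hent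
  exact abs_le_exp_neg_of_multiplicity hLR.one_le_L hLR.one_le_C₀ hDC.one_le_C₁ hC₂ hDC.d₀_pos
    ha hη hm hdim hmult hent hl hh
    (hDC.bounds _ hηa (Real.rpow_lt_one hη.le hη' (by linarith))).1 hlarge

end

end LocRand

end

theorem mainTheorem10 {G : Type*} [Group G] [MetricSpace G] [IsTopologicalGroup G]
    [CompactSpace G] [MeasurableSpace G] [BorelSpace G]
    (hbi : LocRand.IsBiInvariantMetric G)
    (hball : ∀ η : ℝ, 0 < η → ∃ N : Subgroup G, (N : Set G) = Metric.ball (1 : G) η)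
    {L C₀ C₁ d₀ : ℝ} (hLR : LocRand.IsLocallyRandom G L C₀)
    (hDC : LocRand.DimensionCondition G C₁ d₀)
    (μ : Measure G) [IsProbabilityMeasure μ] (hsymm : μ.map (fun x => x⁻¹) = μ)
    (hdense : Dense (Subgroup.closure μ.support : Set G))
    {a η₀ C₂ : ℝ} (ha : 1 < a) (hη₀ : 0 < η₀) (hη₀' : η₀ < 1) (hC₂ : 0 < C₂)
    (hent : ∀ᶠ i : ℕ in atTop, ∃ l : ℕ,
      (l : ℝ) ≤ C₂ * LocRand.metricEntropy (Set.univ : Set G) (η₀ ^ (a ^ i)) ∧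
      (1 - 1 / (8 * L * d₀ * a)) * LocRand.metricEntropy (Set.univ : Set G) (η₀ ^ (a ^ i))
        ≤ LocRand.renyiEntropy (LocRand.convPow μ l) (η₀ ^ (a ^ i))) :
    (∃ i₀ : ℕ, 1 ≤ i₀ ∧
      ((1 / (16 * C₂ * L * d₀ * a) : ℝ) : EReal)
        ≤ LocRand.gap μ (LocRand.invariants (Metric.ball (1 : G) (η₀ ^ (a ^ i₀))))ᗮ) ∧
    (∃ c : ℝ, 0 < c ∧ ∀ f ∈ LocRand.L2Zero G,
      (inner ℂ (LocRand.convOp μ f) f).re ≤ (1 - c) * ‖f‖ ^ 2) ∧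
    ((∀ N : Subgroup G, IsOpen (N : Set G) → N.index = 2 → (μ.support ∩ N).Nonempty) →
      0 < LocRand.gap μ (LocRand.L2Zero G)) := by
  have hL := hLR.one_le_L
  have hd₀ := hDC.d₀_pos
  have ha0 : 0 < a := by linarith
  set κ : ℝ := 1 / (16 * C₂ * L * d₀ * a) with hκ
  have hκ0 : 0 < κ := by positivity
  have hr1 : Real.exp (-κ) < 1 := Real.exp_lt_one_iff.2 (by linarith)
  have hpow : Tendsto (fun i : ℕ => a ^ i) atTop atTop := tendsto_pow_atTop_atTop_of_one_lt ha
  have hη : ∀ i : ℕ, 0 < η₀ ^ (a ^ i) := fun i => Real.rpow_pos_of_pos hη₀ _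
  have hη1 : ∀ i : ℕ, η₀ ^ (a ^ i) < 1 := fun i => Real.rpow_lt_one hη₀.le hη₀' (by positivity)
  have hstep : ∀ i : ℕ, η₀ ^ (a ^ (i + 1)) = (η₀ ^ (a ^ i)) ^ a := fun i => by
    rw [← Real.rpow_mul hη₀.le, pow_succ]
  have hlim : Tendsto (fun i : ℕ => η₀ ^ (a ^ i)) atTop (𝓝 0) :=
    (tendsto_rpow_atTop_of_base_lt_one η₀ (by linarith) hη₀').comp hpow
  have hlog : Tendsto (fun i : ℕ => 3 / 4 * -Real.log (η₀ ^ (a ^ i))) atTop atTop := by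
    simp only [Real.log_rpow hη₀]
    have : ∀ i : ℕ, 3 / 4 * -(a ^ i * Real.log η₀) = (3 / 4 * -Real.log η₀) * a ^ i :=
      fun i => by ring
    simp only [this]
    exact hpow.const_mul_atTop (mul_pos (by norm_num) (neg_pos.2 (Real.log_neg hη₀ hη₀')))
  obtain ⟨i₁, hi₁⟩ := eventually_atTop.1 (hent.and (hlog.eventually_gt_atTop
    (Real.log C₀ + Real.log C₁ / (4 * d₀ * a))))
  set i₀ := max 1 i₁
  let H : ℕ → Submodule ℂ (LocRand.L2 G) := fun i =>
    LocRand.invariants (Metric.ball (1 : G) (η₀ ^ (a ^ i)))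
  have hfd : ∀ i, FiniteDimensional ℂ (H i) := fun i => by
    obtain ⟨N, hN⟩ := hball _ (hη i)
    have := LocRand.finiteDimensional_invariants (N := N) (hN ▸ Metric.isOpen_ball)
    rwa [hN] at this
  have hmono : Monotone H := fun i j hij => LocRand.invariants_anti (Metric.ball_subset_ball
    (Real.rpow_le_rpow_of_exponent_ge hη₀ hη₀'.le (pow_le_pow_right₀ ha.le hij)))
  have hT := LocRand.isSymmetric_convOp μ hsymm
  have hH : ∀ i, ∀ v ∈ H i, LocRand.convOp μ v ∈ H i := fun i v hv =>
    LocRand.convOp_mem_invariants μ hv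
  have hbound : ∀ f ∈ (H i₀)ᗮ, ‖LocRand.convOp μ f‖ ≤ Real.exp (-κ) * ‖f‖ := by
    refine LocRand.norm_map_le_of_chain _ hT H hmono
      (LocRand.top_le_topologicalClosure_iSup_invariants hbi hball hη hlim) hH
      (Real.exp_pos _).le i₀ fun i hi c v hv hv' hne hc => ?_
    have hi' : i₁ ≤ i := (le_max_right 1 i₁).trans hi
    -- Entropy is used at the finer scale `η_{i+1} = η_i ^ a`, where the eigenvector lives; the
    -- largeness condition is used at `η_i`, to whose invariants it is orthogonal.
    obtain ⟨l, hl, hle⟩ := (hi₁ (i + 1) (by omega)).1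
    simp only [H, hstep] at hl hle hv
    exact LocRand.abs_eigenvalue_le hbi hball hLR hDC μ ha hC₂ (hη i) (hη1 i) hl hle
      (hi₁ i hi').2 hv hv' hne hc
  obtain ⟨N, hN⟩ := hball _ (hη i₀)
  have hopen : IsOpen (N : Set G) := hN ▸ Metric.isOpen_ball
  have hnormal := hbi.normal hN
  have hHN : H i₀ = LocRand.invariants (N : Set G) := by rw [hN]
  have hZ : (H i₀)ᗮ ≤ LocRand.L2Zero G := LocRand.orthogonal_invariants_le_L2Zero _
  have hfd' : FiniteDimensional ℂ (H i₀ ⊓ LocRand.L2Zero G : Submodule ℂ (LocRand.L2 G)) :=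
    Submodule.finiteDimensional_of_le inf_le_left
  have hK : ∀ v ∈ H i₀ ⊓ LocRand.L2Zero G, LocRand.convOp μ v ∈ H i₀ ⊓ LocRand.L2Zero G :=
    fun v hv => ⟨hH i₀ v hv.1, LocRand.convOp_mem_L2Zero μ hsymm hv.2⟩
  have hne1 : ∀ (l : ℝ), ∀ v ∈ H i₀ ⊓ LocRand.L2Zero G, v ≠ 0 →
      LocRand.convOp μ v = (l : ℂ) • v → l < 1 := fun l v hv hne hl => by
    refine lt_of_le_of_ne (le_of_abs_le (LocRand.abs_eigenvalue_le_one μ hne hl)) ?_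
    rintro rfl
    exact LocRand.eigenvalue_ne_one μ hdense hopen (hHN ▸ hv.1) hv.2 hne (by simpa using hl)
  refine ⟨⟨i₀, le_max_left _ _, ?_⟩, ?_, fun hmeet => ?_⟩
  · simpa using LocRand.le_gap μ (Real.exp_pos _) hbound
  · obtain ⟨r, hr, hrK⟩ := LocRand.exists_re_inner_map_le_of_eigenvalue_lt _ hT _ hK hne1
    -- `r` governs the finite-dimensional block and `exp (-κ)` its complement; both are below one.
    refine ⟨1 - max r (Real.exp (-κ)), sub_pos.2 (max_lt hr hr1), ?_⟩
    rw [sub_sub_cancel]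
    refine LocRand.re_inner_map_le_of_split hT hZ (hH i₀) (fun v hv => (hrK v hv).trans ?_)
      fun v hv => ?_
    · gcongr
      exact le_max_left _ _
    · calc (inner ℂ (LocRand.convOp μ v) v).re ≤ ‖LocRand.convOp μ v‖ * ‖v‖ :=
            re_inner_le_norm (𝕜 := ℂ) _ _
        _ ≤ Real.exp (-κ) * ‖v‖ * ‖v‖ := by gcongr; exact hbound v hv
        _ = Real.exp (-κ) * ‖v‖ ^ 2 := by ring
        _ ≤ _ := by gcongr; exact le_max_right _ _
  · obtain ⟨r, hr0, hr, hrK⟩ := LocRand.exists_norm_map_le_of_abs_eigenvalue_lt _ hT _ hK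
      fun l v hv hne hl => by
        refine abs_lt.2 ⟨lt_of_le_of_ne ?_ ?_, hne1 l v hv hne hl⟩
        · exact neg_le_of_abs_le (LocRand.abs_eigenvalue_le_one μ hne hl)
        · rintro rfl
          exact LocRand.eigenvalue_ne_neg_one μ hdense hmeet hopen (hHN ▸ hv.1) hne
            (by simpa using hl)
    -- `r` may be zero, but the maximum is positive, so its logarithm is meaningful.
    have hpos : 0 < max r (Real.exp (-κ)) := lt_max_of_lt_right (Real.exp_pos _)
    refine lt_of_lt_of_le ?_ (LocRand.le_gap μ hpos
      (LocRand.norm_map_le_of_split hT hZ (hH i₀) hpos.le (fun v hv => (hrK v hv).trans ?_)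
        fun v hv => (hbound v hv).trans ?_))
    · exact_mod_cast neg_pos.2 (Real.log_neg hpos (max_lt hr hr1))
    · gcongr
      exact le_max_left _ _
    · gcongr
      exact le_max_right _ _
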